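/- **Setting.** Let $\mathcal X,\mathcal U,\mathcal Y,\mathcal W$ be (real or complex) Hilbert spaces, and let $S=\begin{pmatrix}A\&B\\ C\&D\end{pmatrix}:\operatorname{dom}(S)\subset\mathcal X\times\mathcal U\to\mathcal X\times\mathcal Y$ be a *system node* on $(\mathcal U,\mathcal X,\mathcal Y)$: $S$ is a closed linear operator; the operator $Ax=A\&B\binom{x}{0}$ with $\operatorname{dom}(A)=\{x:\binom x0\in\operatorname{dom}(S)\}$ generates a strongly continuous semigroup on $\mathcal X$; and for every $u\in\mathcal U$ there is $x\in\mathcal X$ with $\binom xu\in\operatorname{dom}(S)$. Here $\operatorname{dom}(A\&B)=\operatorname{dom}(S)$, with the graph norm of $A\&B$. A *classical trajectory* on an interval $I=[0,t]$ or $I=\mathbb R_{\ge0}$ is a triple $(x,u,y)$ with $x\in C^1(I;\mathcal X)$, $u\in C(I;\mathcal U)$, $y\in C(I;\mathcal Y)$, $\binom{x(\tau)}{u(\tau)}\in\operatorname{dom}(S)$ and $\binom{\dot x(\tau)}{y(\tau)}=S\binom{x(\tau)}{u(\tau)}$ for all $\tau\in I$. A *generalized trajectory* on $\mathbb R_{\ge0}$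 is a triple $(x,u,y)\in C(\mathbb R_{\ge0};\mathcal X)\times L^2_{\rm loc}(\mathbb R_{\ge0};\mathcal U)\times L^2_{\rm loc}(\mathbb R_{\ge0};\mathcal Y)$ that is the limit, in these spaces, of a sequence of classical trajectories on $\mathbb R_{\ge0}$. Let $Q=Q^*\in\mathcal L(\mathcal Y)$, $N\in\mathcal L(\mathcal U,\mathcal Y)$, $R=R^*\in\mathcal L(\mathcal U)$, and put $$s(y,u)=\left\langle\binom yu,\begin{pmatrix}Q&N\\N^*&R\end{pmatrix}\binom yu\right\rangle,\qquad J(u,y)=\int_0^\infty s(y(\tau),u(\tau))\,d\tau .$$ **Assumption 1 (dissipativity).** $\mathcal S:\mathcal X\to\mathbb R$ is a bounded real quadratic form such that, for every $t\ge0$ and every classical trajectory $(x,u,y)$ on $[0,t]$, $$\mathcal S(x(t))-\mathcal S(x(0))+\int_0^t s(y(\tau),u(\tau))\,d\tau\ge0 .$$ **Assumption 2 (state-feedback stabilizability).** There is a bounded operator $F\&G\in\mathcal L(\operatorname{dom}(A\&B),\mathcal U)$ such that the map $M\binom xu=\binom{x}{u-F\&G\binom xu}$ is injective on $\operatorname{dom}(S)$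 and the closed-loop operator $S_K=\begin{pmatrix}A\&B\\C\&D\\F\&G\end{pmatrix}M^{-1}$ with domain $\operatorname{ran}M$ is a system node on $(\mathcal U,\mathcal X,\mathcal Y\times\mathcal U)$ that is infinite-time well-posed (there is a constant $c$ such that every generalized trajectory $(x,v,y_K)$ of $S_K$ satisfies $\|x(t)\|^2+\|y_K\|^2_{L^2([0,t])}\le c(\|x(0)\|^2+\|v\|^2_{L^2([0,t])})$ for all $t>0$), and whose semigroup $T$ is strongly stable ($T(t)x\to0$ as $t\to\infty$ for every $x\in\mathcal X$). **Theorem.** Suppose that Assumptions 1 and 2 hold. Let $P=P^*\in\mathcal L(\mathcal X)$ be the operator with $\mathcal S(x)=\langle x,Px\rangle$ for all $x\in\mathcal X$, and let $K\&L\in\mathcal L(\operatorname{dom}(A\&B),\mathcal W)$ satisfy $$2\operatorname{Re}\left\langle Px,A\&B\tbinom xu\right\rangle+s\left(C\&D\tbinom xu,u\right)=\left\|K\&L\tbinom xu\right\|^2_{\mathcal W}\qquad\text{for all }\tbinom xu\in\operatorname{dom}(A\&B).$$ Then for every $x_0\in\mathcal X$: 1. There is $u\in L^2(\mathbb R_{\ge0};\mathcal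 U)$ such that, for some $y\in L^2(\mathbb R_{\ge0};\mathcal Y)$ and some $x\in C(\mathbb R_{\ge0};\mathcal X)$ with $x(0)=x_0$ and $\lim_{t\to\infty}x(t)=0$, the triple $(x,u,y)$ is a generalized trajectory of $S$ on $\mathbb R_{\ge0}$. 2. For every generalized trajectory $(x,u,y)$ of $S$ with $x(0)=x_0$, $u\in L^2(\mathbb R_{\ge0};\mathcal U)$, $y\in L^2(\mathbb R_{\ge0};\mathcal Y)$ and $\lim_{t\to\infty}x(t)=0$, the integral $J(u,y)$ converges absolutely, and the dissipation output $w=K\&L\binom xu$, that is, the function $w$ for which $\left(x,u,\binom yw\right)$ is a generalized trajectory of the extended system $\begin{pmatrix}A\&B\\C\&D\\K\&L\end{pmatrix}$, exists, is unique up to equality almost everywhere, lies in $L^2(\mathbb R_{\ge0};\mathcal W)$, and satisfies $$\|w\|^2_{L^2(\mathbb R_{\ge0};\mathcal W)}=-\mathcal S(x_0)+J(u,y)<\infty .$$ -/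

import Mathlib

open MeasureTheory Set Filter Topology
open scoped InnerProductSpace

/- Throughout, `𝕜` is `ℝ` or `ℂ`, and the time axis `ℝ≥0` is the subset `Ici 0` of `ℝ`: functions of
time have type `ℝ → E`, and only their values at nonnegative times matter.

Products such as `X × U` carry the maximum norm, which is equivalent to the Hilbert space norm of the
product. Closedness, boundedness, convergence, square integrability and well-posedness depend on the
norms only up to equivalence, so they are defined for normed spaces. -/

namespace SysNode

noncomputable section

section Semigroups

variable {𝕜 X : Type*} [RCLike 𝕜] [NormedAddCommGroup X] [NormedSpace 𝕜 X]

/-- `T` (restricted to nonnegative times) is a strongly continuous semigroup of bounded linear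
operators on `X`. -/
structure IsC0Semigroup (T : ℝ → X →L[𝕜] X) : Prop where
  map_zero : T 0 = ContinuousLinearMap.id 𝕜 X
  map_add : ∀ s t : ℝ, 0 ≤ s → 0 ≤ t → T (s + t) = (T s).comp (T t)
  continuousOn : ∀ x : X, ContinuousOn (fun t => T t x) (Ici 0)

/-- `A` is the infinitesimal generator of `T`: `x ∈ dom A` and `A x = y` if and only if
`(T t x - x) / t → y` as `t → 0+`. -/
def IsGenerator [NormedSpace ℝ X] (A : X →ₗ.[𝕜] X) (T : ℝ → X →L[𝕜] X) : Prop :=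
  ∀ x y : X, (x, y) ∈ A.graph ↔
    Tendsto (fun t : ℝ => t⁻¹ • (T t x - x)) (𝓝[>] 0) (𝓝 y)

/-- Strong stability of a semigroup. -/
def IsStronglyStable (T : ℝ → X →L[𝕜] X) : Prop :=
  ∀ x : X, Tendsto (fun t => T t x) atTop (𝓝 0)

/-- A bounded real quadratic form on `X`: a real-valued map that is the diagonal of a bounded
sesquilinear form. -/
def IsBoundedQuadraticForm (𝕜 : Type*) {X : Type*} [RCLike 𝕜] [NormedAddCommGroup X]
    [NormedSpace 𝕜 X] (q : X → ℝ) : Prop :=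
  ∃ b : X →L⋆[𝕜] X →L[𝕜] 𝕜, ∀ x : X, ((q x : ℝ) : 𝕜) = b x x

end Semigroups

section Nodes

variable {𝕜 X U Y W : Type*} [RCLike 𝕜]
  [NormedAddCommGroup X] [NormedSpace 𝕜 X]
  [NormedAddCommGroup U] [NormedSpace 𝕜 U]
  [NormedAddCommGroup Y] [NormedSpace 𝕜 Y]
  [NormedAddCommGroup W] [NormedSpace 𝕜 W]

/-- The main operator `A` of `S = [A&B; C&D]`: `dom A = {x | (x, 0) ∈ dom S}`, `A x = A&B (x, 0)`. -/
def mainOperator (S : X × U →ₗ.[𝕜] X × Y) : X →ₗ.[𝕜] X where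
  domain := S.domain.comap (LinearMap.inl 𝕜 X U)
  toFun := LinearMap.fst 𝕜 X Y ∘ₗ S.toFun ∘ₗ
    (LinearMap.inl 𝕜 X U).restrict (fun _ hx => hx)

/-- `S = [A&B; C&D]` is a system node on `(U, X, Y)`. (The operators `A&B` and `C&D`, the two
components of `S`, have the same domain as `S`.) -/
structure IsSystemNode [NormedSpace ℝ X] (S : X × U →ₗ.[𝕜] X × Y) : Prop where
  isClosed : S.IsClosed
  generates : ∃ T : ℝ → X →L[𝕜] X, IsC0Semigroup T ∧ IsGenerator (mainOperator S) T
  exists_state : ∀ u : U, ∃ x : X, (x, u) ∈ S.domain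

/-- `K` belongs to `L(dom(A&B), W)`: it is bounded with respect to the graph norm of `A&B`. -/
def IsGraphBounded (S : X × U →ₗ.[𝕜] X × Y) (K : S.domain →ₗ[𝕜] W) : Prop :=
  ∃ c : ℝ, ∀ z : S.domain, ‖K z‖ ≤ c * (‖(z : X × U)‖ + ‖(S z).1‖)

/-- The linear map `z ↦ (A&B z, (C&D z, K z))` on `dom S`. -/
def extendedMap (S : X × U →ₗ.[𝕜] X × Y) (K : S.domain →ₗ[𝕜] W) :
    S.domain →ₗ[𝕜] X × (Y × W) :=
  (LinearMap.fst 𝕜 X Y ∘ₗ S.toFun).prod ((LinearMap.snd 𝕜 X Y ∘ₗ S.toFun).prod K)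

/-- The operator `[A&B; C&D; K]` with domain `dom S`, i.e. `S` with the additional output `K`. -/
def extendedNode (S : X × U →ₗ.[𝕜] X × Y) (K : S.domain →ₗ[𝕜] W) :
    X × U →ₗ.[𝕜] X × (Y × W) where
  domain := S.domain
  toFun := extendedMap S K

/-- `(x, u, y)` is a classical trajectory of `(x', y) = S (x, u)` on the interval `I`. -/
structure IsClassicalTrajectory [NormedSpace ℝ X] (S : X × U →ₗ.[𝕜] X × Y) (I : Set ℝ)
    (x : ℝ → X) (u : ℝ → U) (y : ℝ → Y) : Prop where
  state : ContDiffOn ℝ 1 x I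
  input : ContinuousOn u I
  output : ContinuousOn y I
  /-- `(x t, u t) ∈ dom S` and `(x' t, y t) = S (x t, u t)` for all `t ∈ I`. -/
  mem_graph : ∀ t ∈ I, ((x t, u t), (derivWithin x I t, y t)) ∈ S.graph

/-- `f ∈ L²(ℝ≥0; E)`. -/
def MemL2 {E : Type*} [NormedAddCommGroup E] (f : ℝ → E) : Prop :=
  MemLp f 2 (volume.restrict (Ici 0))

/-- `f ∈ L²_loc(ℝ≥0; E)`. Every compact subset of `ℝ≥0` lies in some `[0, t]`. -/
def MemL2Loc {E : Type*} [NormedAddCommGroup E] (f : ℝ → E) : Prop :=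
  ∀ t : ℝ, MemLp f 2 (volume.restrict (Icc 0 t))

/-- `f k → g` in `L²_loc(ℝ≥0; E)`. -/
def TendstoL2Loc {E : Type*} [NormedAddCommGroup E] (f : ℕ → ℝ → E) (g : ℝ → E) : Prop :=
  ∀ t : ℝ, Tendsto (fun k => eLpNorm (f k - g) 2 (volume.restrict (Icc 0 t))) atTop (𝓝 0)

/-- `(x, u, y)` is a generalized trajectory of `(x', y) = S (x, u)` on `ℝ≥0`. -/
structure IsGeneralizedTrajectory [NormedSpace ℝ X] (S : X × U →ₗ.[𝕜] X × Y)
    (x : ℝ → X) (u : ℝ → U) (y : ℝ → Y) : Prop where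
  state : ContinuousOn x (Ici 0)
  input : MemL2Loc u
  output : MemL2Loc y
  approx : ∃ (xk : ℕ → ℝ → X) (uk : ℕ → ℝ → U) (yk : ℕ → ℝ → Y),
    (∀ k, IsClassicalTrajectory S (Ici 0) (xk k) (uk k) (yk k)) ∧
    (∀ t : ℝ, TendstoUniformlyOn xk x atTop (Icc 0 t)) ∧
    TendstoL2Loc uk u ∧ TendstoL2Loc yk y

/-- Infinite-time well-posedness: the well-posedness constant does not depend on `t`. -/
def IsInfiniteTimeWellPosed [NormedSpace ℝ X] (S : X × U →ₗ.[𝕜] X × Y) : Prop :=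
  ∃ c : ℝ, ∀ t : ℝ, 0 < t → ∀ (x : ℝ → X) (u : ℝ → U) (y : ℝ → Y),
    IsGeneralizedTrajectory S x u y →
      ‖x t‖ ^ 2 + ∫ τ in (0 : ℝ)..t, ‖y τ‖ ^ 2 ≤
        c * (‖x 0‖ ^ 2 + ∫ τ in (0 : ℝ)..t, ‖u τ‖ ^ 2)

/-- The operator `M = I - [0; F&G]` from `dom S` to `X × U`, i.e. `(x, u) ↦ (x, u - F&G (x, u))`. -/
def feedbackMap (S : X × U →ₗ.[𝕜] X × Y) (FG : S.domain →ₗ[𝕜] U) : S.domain →ₗ[𝕜] X × U :=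
  S.domain.subtype - LinearMap.inr 𝕜 X U ∘ₗ FG

/-- The closed-loop operator `S_K = [A&B; C&D; F&G] M⁻¹` with domain `ran M`. It describes the system
with the additional output `z = F&G (x, u)` under the feedback `u = z + v`, with input `v` and output
`(y, z)`. -/
def closedLoop (S : X × U →ₗ.[𝕜] X × Y) (FG : S.domain →ₗ[𝕜] U)
    (hM : Function.Injective (feedbackMap S FG)) : X × U →ₗ.[𝕜] X × (Y × U) where
  domain := LinearMap.range (feedbackMap S FG)
  toFun := extendedMap S FG ∘ₗ (LinearEquiv.ofInjective (feedbackMap S FG) hM).symm.toLinearMap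

/-- `S` is state-feedback stabilizable: some admissible state feedback `F&G ∈ L(dom(A&B), U)` (that
is, one whose closed loop is a system node) makes the closed loop infinite-time well-posed with a
strongly stable semigroup. -/
def IsStateFeedbackStabilizable [NormedSpace ℝ X] (S : X × U →ₗ.[𝕜] X × Y) : Prop :=
  ∃ FG : S.domain →ₗ[𝕜] U, IsGraphBounded S FG ∧
    ∃ hM : Function.Injective (feedbackMap S FG),
      IsSystemNode (closedLoop S FG hM) ∧
      IsInfiniteTimeWellPosed (closedLoop S FG hM) ∧
      ∃ T : ℝ → X →L[𝕜] X, IsC0Semigroup T ∧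
        IsGenerator (mainOperator (closedLoop S FG hM)) T ∧ IsStronglyStable T

end Nodes

section LinearQuadratic

variable {𝕜 X U Y W : Type*} [RCLike 𝕜]
  [NormedAddCommGroup X] [InnerProductSpace 𝕜 X]
  [NormedAddCommGroup U] [InnerProductSpace 𝕜 U]
  [NormedAddCommGroup Y] [InnerProductSpace 𝕜 Y]
  [NormedAddCommGroup W] [InnerProductSpace 𝕜 W]

/-- The supply rate `s(y, u) = ⟨(y, u), [Q N; N* R] (y, u)⟩`. The inner product is real when `Q` and
`R` are self-adjoint, so that taking the real part only changes the type. -/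
def supplyRate [CompleteSpace U] [CompleteSpace Y]
    (Q : Y →L[𝕜] Y) (N : U →L[𝕜] Y) (R : U →L[𝕜] U) (y : Y) (u : U) : ℝ :=
  RCLike.re (⟪y, Q y + N u⟫_𝕜 + ⟪u, ContinuousLinearMap.adjoint N y + R u⟫_𝕜)

/-- Dissipativity of the system with respect to the supply rate `s` and the storage function `V`. -/
def IsDissipative [NormedSpace ℝ X] (S : X × U →ₗ.[𝕜] X × Y) (s : Y → U → ℝ) (V : X → ℝ) : Prop :=
  ∀ t : ℝ, 0 ≤ t → ∀ (x : ℝ → X) (u : ℝ → U) (y : ℝ → Y),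
    IsClassicalTrajectory S (Icc 0 t) x u y →
      0 ≤ V (x t) - V (x 0) + ∫ τ in (0 : ℝ)..t, s (y τ) (u τ)

/-- The operator-node Lur'e equation
`2 Re ⟨P x, A&B (x, u)⟩ + s(C&D (x, u), u) = ‖K&L (x, u)‖²` on `dom(A&B)`. -/
def LureEquation (S : X × U →ₗ.[𝕜] X × Y) (s : Y → U → ℝ) (P : X →L[𝕜] X)
    (KL : S.domain →ₗ[𝕜] W) : Prop :=
  ∀ z : S.domain,
    2 * RCLike.re ⟪P (z : X × U).1, (S z).1⟫_𝕜 + s (S z).2 (z : X × U).2 = ‖KL z‖ ^ 2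

/-- `w` is the dissipation output `K&L (x, u)` along the generalized trajectory `(x, u, y)`:
`(x, u, (y, w))` is a generalized trajectory of the extended system `[A&B; C&D; K&L]`. -/
def IsDissipationOutput [NormedSpace ℝ X] (S : X × U →ₗ.[𝕜] X × Y) (KL : S.domain →ₗ[𝕜] W)
    (x : ℝ → X) (u : ℝ → U) (y : ℝ → Y) (w : ℝ → W) : Prop :=
  IsGeneralizedTrajectory (extendedNode S KL) x u (fun t => (y t, w t))

/-- The infinite-horizon cost `J(u, y) = ∫₀^∞ s(y, u)`. -/
def cost (s : Y → U → ℝ) (u : ℝ → U) (y : ℝ → Y) : ℝ :=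
  ∫ τ in Ici (0 : ℝ), s (y τ) (u τ)

/-- `(x, u, y)` is a generalized trajectory with `x 0 = x₀`, `u` and `y` square integrable on `ℝ≥0`,
and `x t → 0` as `t → ∞`. -/
structure IsStableTrajectoryFrom [NormedSpace ℝ X] (S : X × U →ₗ.[𝕜] X × Y) (x₀ : X)
    (x : ℝ → X) (u : ℝ → U) (y : ℝ → Y) : Prop where
  generalized : IsGeneralizedTrajectory S x u y
  initial : x 0 = x₀
  input : MemL2 u
  output : MemL2 y
  tendsto_zero : Tendsto x atTop (𝓝 0)

end LinearQuadratic

end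

end SysNode

/-! Along a classical trajectory the Lur'e equation says that the derivative of ⟨x, Px⟩ is ‖w‖² -
s(y, u), where w = K&L(x, u). Integration gives the dissipation balance on [0, t]
(`IsClassicalTrajectory.integral_sq_eq`): the L² norm of w is determined by the end states and the
integral of s.

By linearity the balance also holds for differences of classical trajectories. If the end states
converge and inputs and outputs converge in L² on [0, t], then the dissipation outputs are Cauchy in
L² on [0, t] (`tendsto_dissipationOutput_sub`). Completeness yields w for a generalized trajectory,
and comparison of two approximating sequences yields its uniqueness. All terms of the balance are
continuous under these limits, so it persists. Letting t tend to infinity, ⟨x(t), Px(t)⟩ vanishes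
and the integral of s converges because u and y lie in L². No sign of P is needed, since the
equation is an identity with a square.

For the existence of a stable trajectory, run the closed loop with input v = 0. Orbits starting in
the domain of its generator are classical; this domain is dense, and well-posedness with a constant
independent of t carries outputs to the limit and makes them square integrable on the half-line
(`exists_tendsto_orbit`). The output z = F&G(x, u) is the required input, and strong stability
drives the state to zero. -/

namespace SysNode

/-! ### Quadratic functionals and limits in L². -/

section SquareIntegrable

variable {α ι E F : Type*} [MeasurableSpace α] {μ : Measure α}
  [NormedAddCommGroup E] [NormedAddCommGroup F]

theorem eLpNorm_two_eq_ofReal_sqrt {f : α → E} (hf : MemLp f 2 μ) :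
    eLpNorm f 2 μ = ENNReal.ofReal (√(∫ a, ‖f a‖ ^ 2 ∂μ)) := by
  rw [hf.eLpNorm_eq_integral_rpow_norm two_ne_zero ENNReal.ofNat_ne_top, Real.sqrt_eq_rpow]
  simp

theorem tendsto_eLpNorm_two_zero_iff {l : Filter ι} {f : ι → α → E} (hf : ∀ i, MemLp (f i) 2 μ) :
    Tendsto (fun i => eLpNorm (f i) 2 μ) l (𝓝 0) ↔
      Tendsto (fun i => ∫ a, ‖f i a‖ ^ 2 ∂μ) l (𝓝 0) := by
  have hnn : ∀ i, 0 ≤ ∫ a, ‖f i a‖ ^ 2 ∂μ := fun i => integral_nonneg fun a => by positivity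
  simp_rw [eLpNorm_two_eq_ofReal_sqrt (hf _)]
  constructor
  · intro h
    have h1 := ((ENNReal.tendsto_toReal ENNReal.zero_ne_top).comp h).pow 2
    simpa [Function.comp_def, ENNReal.toReal_ofReal, Real.sq_sqrt, hnn] using h1
  · intro h
    simpa using ENNReal.tendsto_ofReal (h.sqrt)

/-- The hypothesis is the only property of bounded quadratic forms used for limits. It covers both
the squared norm and the supply rate. -/
theorem continuous_of_quadratic {b : E → ℝ} {C : ℝ}
    (hb : ∀ v w, |b v - b w| ≤ C * (‖v - w‖ * (‖v‖ + ‖w‖))) : Continuous b := by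
  refine continuous_iff_continuousAt.2 fun w => ?_
  refine tendsto_iff_norm_sub_tendsto_zero.2 (squeeze_zero (fun _ => norm_nonneg _)
    (fun v => hb v w) ?_)
  have : Continuous fun v : E => C * (‖v - w‖ * (‖v‖ + ‖w‖)) := by fun_prop
  simpa using this.tendsto w

theorem integrable_of_quadratic {b : E → ℝ} {C : ℝ}
    (hb : ∀ v w, |b v - b w| ≤ C * (‖v - w‖ * (‖v‖ + ‖w‖))) (hb0 : b 0 = 0)
    {f : α → E} (hf : MemLp f 2 μ) : Integrable (fun a => b (f a)) μ := by
  refine (((memLp_two_iff_integrable_sq_norm hf.1).1 hf).const_mul C).mono'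
    ((continuous_of_quadratic hb).comp_aestronglyMeasurable hf.1) (ae_of_all _ fun a => ?_)
  simpa [hb0, sq] using hb (f a) 0

/-- A function of quadratic growth, such as a bounded quadratic form, has a continuous integral
along convergent sequences of `L²`. -/
theorem tendsto_integral_of_quadratic {l : Filter ι} {b : E → ℝ} {C : ℝ}
    (hb : ∀ v w, |b v - b w| ≤ C * (‖v - w‖ * (‖v‖ + ‖w‖))) (hb0 : b 0 = 0)
    {f : ι → α → E} {g : α → E} (hf : ∀ i, MemLp (f i) 2 μ) (hg : MemLp g 2 μ)
    (h : Tendsto (fun i => eLpNorm (f i - g) 2 μ) l (𝓝 0)) :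
    Tendsto (fun i => ∫ a, b (f i a) ∂μ) l (𝓝 (∫ a, b (g a) ∂μ)) := by
  refine tendsto_integral_of_L1 _ (integrable_of_quadratic hb hb0 hg).1
    (.of_forall fun i => integrable_of_quadratic hb hb0 (hf i)) ?_
  -- Hölder with exponents 2 and 2 for ‖f - g‖ and ‖f‖ + ‖g‖, where ‖f‖ is replaced by ‖f - g‖ + ‖g‖
  -- so that the bound involves only the quantity tending to zero.
  have key : ∀ i, ∫⁻ a, ‖b (f i a) - b (g a)‖ₑ ∂μ ≤
      ‖C‖₊ * eLpNorm (f i - g) 2 μ * (eLpNorm (f i - g) 2 μ + 2 * eLpNorm g 2 μ) := by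
    intro i
    have hsum : eLpNorm (fun a => ‖f i a‖ + ‖g a‖) 2 μ ≤
        eLpNorm (f i - g) 2 μ + 2 * eLpNorm g 2 μ := by
      refine (eLpNorm_add_le (hf i).1.norm hg.1.norm one_le_two).trans ?_
      rw [eLpNorm_norm, eLpNorm_norm, two_mul, ← add_assoc]
      gcongr
      simpa using eLpNorm_add_le ((hf i).1.sub hg.1) hg.1 one_le_two
    refine le_trans ?_ (mul_le_mul_right hsum _)
    refine le_trans ?_ (eLpNorm_le_eLpNorm_mul_eLpNorm_of_nnnorm (p := 2) (q := 2) (r := 1)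
      ((hf i).1.sub hg.1) ((hf i).1.norm.add hg.1.norm)
      (fun v r => C * (‖v‖ * r)) ‖C‖₊ (ae_of_all _ fun a => ?_))
    · rw [eLpNorm_one_eq_lintegral_enorm]
      refine lintegral_mono fun a => ?_
      rw [enorm_le_iff_norm_le]
      exact (hb _ _).trans (le_abs_self _)
    · simp [nnnorm_mul, mul_assoc]
  refine tendsto_of_tendsto_of_tendsto_of_le_of_le tendsto_const_nhds ?_ (fun _ => zero_le) key
  have h1 := ENNReal.Tendsto.const_mul (a := (‖C‖₊ : ENNReal)) h (.inr ENNReal.coe_ne_top)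
  have h2 := h.add_const (2 * eLpNorm g 2 μ)
  have h3 := ENNReal.Tendsto.mul h1 (.inr (by
    simpa using ENNReal.mul_ne_top ENNReal.ofNat_ne_top hg.2.ne)) h2 (.inr (by simp))
  simpa using h3

theorem abs_norm_sq_sub_le (v w : E) :
    |‖v‖ ^ 2 - ‖w‖ ^ 2| ≤ 1 * (‖v - w‖ * (‖v‖ + ‖w‖)) := by
  rw [sq_sub_sq, abs_mul, abs_of_nonneg (by positivity : 0 ≤ ‖v‖ + ‖w‖), one_mul, mul_comm]
  gcongr
  exact abs_norm_sub_norm_le v w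

/-- Two independent indices serve both purposes: one sequence against itself gives the Cauchy
property, two sequences with a common limit give uniqueness. -/
theorem tendsto_eLpNorm_sub_sub {p : ENNReal} (hp : 1 ≤ p) {κ : Type*} {l : Filter ι}
    {l' : Filter κ} {f : ι → α → E} {f' : κ → α → E} {g : α → E}
    (hf : ∀ i, AEStronglyMeasurable (f i) μ) (hf' : ∀ i, AEStronglyMeasurable (f' i) μ)
    (hg : AEStronglyMeasurable g μ) (h : Tendsto (fun i => eLpNorm (f i - g) p μ) l (𝓝 0))
    (h' : Tendsto (fun i => eLpNorm (f' i - g) p μ) l' (𝓝 0)) :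
    Tendsto (fun i : ι × κ => eLpNorm (f i.1 - f' i.2) p μ) (l ×ˢ l') (𝓝 0) := by
  have := (h.comp tendsto_fst).add (h'.comp (tendsto_snd (f := l)))
  rw [add_zero] at this
  refine tendsto_of_tendsto_of_tendsto_of_le_of_le tendsto_const_nhds this
    (fun _ => zero_le) fun i => ?_
  have := eLpNorm_sub_le ((hf i.1).sub hg) ((hf' i.2).sub hg) hp
  rwa [sub_sub_sub_cancel_right] at this

theorem exists_tendsto_of_cauchy_eLpNorm [CompleteSpace E] {p : ENNReal} [Fact (1 ≤ p)]
    {f : ℕ → α → E} (hf : ∀ k, MemLp (f k) p μ)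
    (h : Tendsto (fun i : ℕ × ℕ => eLpNorm (f i.1 - f i.2) p μ) atTop (𝓝 0)) :
    ∃ g, MemLp g p μ ∧ Tendsto (fun k => eLpNorm (f k - g) p μ) atTop (𝓝 0) := by
  have hc : CauchySeq fun k => (hf k).toLp (f k) := by
    refine (Lp.cauchySeq_Lp_iff_cauchySeq_eLpNorm _).2 (h.congr fun i => eLpNorm_congr_ae ?_)
    exact ((hf i.1).coeFn_toLp.sub (hf i.2).coeFn_toLp).symm
  obtain ⟨g, hg⟩ := cauchySeq_tendsto_of_complete hc
  refine ⟨g, Lp.memLp g, ((Lp.tendsto_Lp_iff_tendsto_eLpNorm' _ _).1 hg).congr fun i =>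
    eLpNorm_congr_ae ?_⟩
  exact (hf i).coeFn_toLp.sub .rfl

theorem ae_eq_of_tendsto_eLpNorm {p : ENNReal} (hp : 1 ≤ p) {l : Filter ι} [l.NeBot]
    {f : ι → α → E} {g g' : α → E} (hf : ∀ i, AEStronglyMeasurable (f i) μ)
    (hg : AEStronglyMeasurable g μ) (hg' : AEStronglyMeasurable g' μ)
    (h : Tendsto (fun i => eLpNorm (f i - g) p μ) l (𝓝 0))
    (h' : Tendsto (fun i => eLpNorm (f i - g') p μ) l (𝓝 0)) : g =ᵐ[μ] g' := by
  have hle : ∀ i, eLpNorm (g - g') p μ ≤ eLpNorm (f i - g') p μ + eLpNorm (f i - g) p μ := by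
    intro i
    have := eLpNorm_sub_le ((hf i).sub hg') ((hf i).sub hg) hp
    rwa [sub_sub_sub_cancel_left] at this
  have h0 : eLpNorm (g - g') p μ = 0 :=
    le_antisymm (ge_of_tendsto' (by simpa using h'.add h) hle) zero_le
  rw [eLpNorm_eq_zero_iff (hg.sub hg') (by positivity)] at h0
  filter_upwards [h0] with a ha using sub_eq_zero.1 ha

theorem eLpNorm_prod_le {p : ENNReal} (hp : 1 ≤ p) {f : α → E} {g : α → F}
    (hf : AEStronglyMeasurable f μ) (hg : AEStronglyMeasurable g μ) :
    eLpNorm (fun a => (f a, g a)) p μ ≤ eLpNorm f p μ + eLpNorm g p μ := by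
  rw [← eLpNorm_norm f, ← eLpNorm_norm g]
  refine le_trans (eLpNorm_mono_real fun a => ?_) (eLpNorm_add_le hf.norm hg.norm hp)
  simp [Prod.norm_def]

theorem memLp_prod {p : ENNReal} (hp : 1 ≤ p) {f : α → E} {g : α → F}
    (hf : MemLp f p μ) (hg : MemLp g p μ) : MemLp (fun a => (f a, g a)) p μ :=
  ⟨hf.1.prodMk hg.1, (eLpNorm_prod_le hp hf.1 hg.1).trans_lt (ENNReal.add_lt_top.2 ⟨hf.2, hg.2⟩)⟩

end SquareIntegrable

/-! ### The space L²_loc on the half-line. -/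

section LocallySquareIntegrable

variable {E F : Type*} [NormedAddCommGroup E] [NormedAddCommGroup F]

theorem _root_.ContinuousOn.memL2Loc {f : ℝ → E} (hf : ContinuousOn f (Ici 0)) : MemL2Loc f := by
  intro t
  have hf' : ContinuousOn f (Icc 0 t) := hf.mono Icc_subset_Ici_self
  have hm := hf'.aestronglyMeasurable (μ := volume) measurableSet_Icc
  rw [memLp_two_iff_integrable_sq_norm hm]
  exact ContinuousOn.integrableOn_Icc (by fun_prop)

theorem MemL2.memL2Loc {f : ℝ → E} (hf : MemL2 f) : MemL2Loc f := fun _ =>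
  hf.mono_measure (Measure.restrict_mono Icc_subset_Ici_self le_rfl)

theorem MemL2Loc.prodMk {f : ℝ → E} {g : ℝ → F} (hf : MemL2Loc f) (hg : MemL2Loc g) :
    MemL2Loc fun t => (f t, g t) := fun t => memLp_prod one_le_two (hf t) (hg t)

theorem MemL2Loc.fst {f : ℝ → E × F} (hf : MemL2Loc f) : MemL2Loc fun t => (f t).1 := fun t =>
  (hf t).mono (hf t).1.fst (ae_of_all _ fun _ => norm_fst_le _)

theorem MemL2Loc.snd {f : ℝ → E × F} (hf : MemL2Loc f) : MemL2Loc fun t => (f t).2 := fun t =>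
  (hf t).mono (hf t).1.snd (ae_of_all _ fun _ => norm_snd_le _)

theorem MemL2.prodMk {f : ℝ → E} {g : ℝ → F} (hf : MemL2 f) (hg : MemL2 g) :
    MemL2 fun t => (f t, g t) := memLp_prod one_le_two hf hg

theorem MemL2.fst {f : ℝ → E × F} (hf : MemL2 f) : MemL2 fun t => (f t).1 :=
  MemLp.mono hf hf.1.fst (ae_of_all _ fun _ => norm_fst_le _)

theorem MemL2.snd {f : ℝ → E × F} (hf : MemL2 f) : MemL2 fun t => (f t).2 :=
  MemLp.mono hf hf.1.snd (ae_of_all _ fun _ => norm_snd_le _)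

theorem TendstoL2Loc.fst {f : ℕ → ℝ → E × F} {g : ℝ → E × F} (h : TendstoL2Loc f g) :
    TendstoL2Loc (fun k t => (f k t).1) fun t => (g t).1 := fun t =>
  tendsto_of_tendsto_of_tendsto_of_le_of_le tendsto_const_nhds (h t) (fun _ => zero_le)
    fun k => eLpNorm_mono fun τ => norm_fst_le (f k τ - g τ)

theorem TendstoL2Loc.snd {f : ℕ → ℝ → E × F} {g : ℝ → E × F} (h : TendstoL2Loc f g) :
    TendstoL2Loc (fun k t => (f k t).2) fun t => (g t).2 := fun t =>
  tendsto_of_tendsto_of_tendsto_of_le_of_le tendsto_const_nhds (h t) (fun _ => zero_le)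
    fun k => eLpNorm_mono fun τ => norm_snd_le (f k τ - g τ)

theorem TendstoL2Loc.prodMk {f : ℕ → ℝ → E} {f' : ℕ → ℝ → F} {g : ℝ → E} {g' : ℝ → F}
    (hf : ∀ k, MemL2Loc (f k)) (hf' : ∀ k, MemL2Loc (f' k)) (hg : MemL2Loc g) (hg' : MemL2Loc g')
    (h : TendstoL2Loc f g) (h' : TendstoL2Loc f' g') :
    TendstoL2Loc (fun k t => (f k t, f' k t)) fun t => (g t, g' t) := by
  intro t
  have hadd := (h t).add (h' t)
  rw [add_zero] at hadd
  exact tendsto_of_tendsto_of_tendsto_of_le_of_le tendsto_const_nhds hadd (fun _ => zero_le)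
    fun k => eLpNorm_prod_le one_le_two ((hf k t).1.sub (hg t).1) ((hf' k t).1.sub (hg' t).1)

/-- Completeness of `L²_loc`. -/
theorem exists_tendstoL2Loc [CompleteSpace E] {f : ℕ → ℝ → E} (hf : ∀ k, MemL2Loc (f k))
    (h : ∀ t, 0 ≤ t → Tendsto
      (fun i : ℕ × ℕ => eLpNorm (f i.1 - f i.2) 2 (volume.restrict (Icc 0 t))) atTop (𝓝 0)) :
    ∃ g, MemL2Loc g ∧ TendstoL2Loc f g := by
  choose g hg hfg using fun n : ℕ => exists_tendsto_of_cauchy_eLpNorm (fun k => hf k n)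
    (h n n.cast_nonneg)
  have hmono : ∀ {s t : ℝ}, s ≤ t → volume.restrict (Icc 0 s) ≤ volume.restrict (Icc 0 t) :=
    fun hst => Measure.restrict_mono (Icc_subset_Icc_right hst) le_rfl
  -- The limits on [0, n] agree off a single null set, since there are countably many pairs. They
  -- are therefore glued by taking at time t the limit for n = ⌈t⌉₊.
  have hcons : ∀ᵐ t : ℝ, ∀ m n : ℕ, m ≤ n → t ∈ Icc (0 : ℝ) m → g m t = g n t := by
    refine ae_all_iff.2 fun m => ae_all_iff.2 fun n => ?_
    by_cases hmn : m ≤ n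
    · have hle : volume.restrict (Icc (0 : ℝ) m) ≤ volume.restrict (Icc (0 : ℝ) n) :=
        hmono (Nat.cast_le.2 hmn)
      have := ae_eq_of_tendsto_eLpNorm one_le_two (fun k => (hf k m).1) (hg m).1
        ((hg n).1.mono_measure hle) (hfg m)
        (tendsto_of_tendsto_of_tendsto_of_le_of_le tendsto_const_nhds (hfg n)
          (fun _ => zero_le) fun k => eLpNorm_mono_measure _ hle)
      filter_upwards [(ae_restrict_iff' measurableSet_Icc).1 this] with t ht _ using ht
    · exact ae_of_all _ fun t hmn' => absurd hmn' hmn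
  have hG : ∀ n : ℕ, (fun t => g ⌈t⌉₊ t) =ᵐ[volume.restrict (Icc (0 : ℝ) n)] g n := by
    intro n
    rw [EventuallyEq, ae_restrict_iff' measurableSet_Icc]
    filter_upwards [hcons] with t ht htn
    exact ht _ _ (Nat.ceil_le.2 htn.2) ⟨htn.1, Nat.le_ceil t⟩
  refine ⟨fun t => g ⌈t⌉₊ t, fun t => ?_, fun t => ?_⟩
  · exact ((memLp_congr_ae (hG ⌈t⌉₊)).2 (hg _)).mono_measure (hmono (Nat.le_ceil t))
  · refine tendsto_of_tendsto_of_tendsto_of_le_of_le tendsto_const_nhds (hfg ⌈t⌉₊)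
      (fun _ => zero_le) fun k => ?_
    refine (eLpNorm_mono_measure _ (hmono (Nat.le_ceil t))).trans_eq (eLpNorm_congr_ae ?_)
    exact EventuallyEq.rfl.sub (hG _)

theorem MemL2Loc.memL2_of_bounded {f : ℝ → E} (hf : MemL2Loc f) {c : ℝ}
    (h : ∀ t, 0 < t → ∫ τ in (0 : ℝ)..t, ‖f τ‖ ^ 2 ≤ c) : MemL2 f := by
  have hm : AEStronglyMeasurable f (volume.restrict (Ici 0)) := by
    have : Ici (0 : ℝ) = ⋃ n : ℕ, Icc (0 : ℝ) n := by
      ext t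
      simpa using fun _ => exists_nat_ge t
    rw [this, aestronglyMeasurable_iUnion_iff]
    exact fun n => (hf n).1
  rw [MemL2, memLp_two_iff_integrable_sq_norm hm]
  refine (integrableOn_Ici_iff_integrableOn_Ioi).2
    (integrableOn_Ioi_of_intervalIntegral_norm_bounded c 0 (b := fun n : ℕ => (n : ℝ))
      (fun n => ?_) tendsto_natCast_atTop_atTop ?_)
  · exact IntegrableOn.mono_set ((memLp_two_iff_integrable_sq_norm (hf n).1).1 (hf n))
      Ioc_subset_Icc_self
  · filter_upwards [eventually_gt_atTop 0] with n hn
    simpa using h n (Nat.cast_pos.2 hn)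

theorem intervalIntegral_eq_integral_Icc {f : ℝ → ℝ} {t : ℝ} (ht : 0 ≤ t) :
    ∫ τ in (0 : ℝ)..t, f τ = ∫ τ in Icc 0 t, f τ := by
  rw [intervalIntegral.integral_of_le ht, integral_Icc_eq_integral_Ioc]

theorem tendsto_intervalIntegral_of_quadratic {b : E → ℝ} {C : ℝ}
    (hb : ∀ v w, |b v - b w| ≤ C * (‖v - w‖ * (‖v‖ + ‖w‖))) (hb0 : b 0 = 0)
    {f : ℕ → ℝ → E} {g : ℝ → E} (hf : ∀ k, MemL2Loc (f k)) (hg : MemL2Loc g)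
    (h : TendstoL2Loc f g) {t : ℝ} (ht : 0 ≤ t) :
    Tendsto (fun k => ∫ τ in (0 : ℝ)..t, b (f k τ)) atTop (𝓝 (∫ τ in (0 : ℝ)..t, b (g τ))) := by
  simp_rw [intervalIntegral_eq_integral_Icc ht]
  exact tendsto_integral_of_quadratic hb hb0 (fun k => hf k t) (hg t) (h t)

end LocallySquareIntegrable

/-! ### Classical trajectories and the extended system. -/

section Trajectories

variable {𝕜 X U Y W : Type*} [RCLike 𝕜]
  [NormedAddCommGroup X] [NormedSpace 𝕜 X]
  [NormedAddCommGroup U] [NormedSpace 𝕜 U]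
  [NormedAddCommGroup Y] [NormedSpace 𝕜 Y]
  [NormedAddCommGroup W] [NormedSpace 𝕜 W]
  {S : X × U →ₗ.[𝕜] X × Y} {KL : S.domain →ₗ[𝕜] W}

theorem mem_graph_extendedNode_iff {z : X × U} {x : X} {y : Y} {w : W} :
    (z, (x, (y, w))) ∈ (extendedNode S KL).graph ↔
      ∃ hz : z ∈ S.domain, S ⟨z, hz⟩ = (x, y) ∧ KL ⟨z, hz⟩ = w := by
  rw [LinearPMap.mem_graph_iff]
  constructor
  · rintro ⟨⟨z', hz'⟩, rfl, h⟩
    refine ⟨hz', ?_⟩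
    have h1 : ((S ⟨z', hz'⟩).1, ((S ⟨z', hz'⟩).2, KL ⟨z', hz'⟩)) = (x, (y, w)) := h
    simp only [Prod.mk.injEq] at h1
    exact ⟨Prod.ext h1.1 h1.2.1, h1.2.2⟩
  · rintro ⟨hz, h, h'⟩
    refine ⟨⟨z, hz⟩, rfl, ?_⟩
    change ((S ⟨z, hz⟩).1, ((S ⟨z, hz⟩).2, KL ⟨z, hz⟩)) = _
    rw [h, h']

variable [NormedSpace ℝ X]

theorem IsClassicalTrajectory.sub {I : Set ℝ} {x x' : ℝ → X}
    {u u' : ℝ → U} {y y' : ℝ → Y} (h : IsClassicalTrajectory S I x u y)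
    (h' : IsClassicalTrajectory S I x' u' y') :
    IsClassicalTrajectory S I (x - x') (u - u') (y - y') where
  state := h.state.sub h'.state
  input := h.input.sub h'.input
  output := h.output.sub h'.output
  mem_graph t ht := by
    have hx := h.state.differentiableOn one_ne_zero t ht
    have hx' := h'.state.differentiableOn one_ne_zero t ht
    rw [derivWithin_sub hx hx']
    exact S.graph.sub_mem (h.mem_graph t ht) (h'.mem_graph t ht)

theorem IsClassicalTrajectory.isGeneralizedTrajectory {x : ℝ → X} {u : ℝ → U} {y : ℝ → Y}
    (h : IsClassicalTrajectory S (Ici 0) x u y) : IsGeneralizedTrajectory S x u y where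
  state := h.state.continuousOn
  input := h.input.memL2Loc
  output := h.output.memL2Loc
  approx := ⟨fun _ => x, fun _ => u, fun _ => y, fun _ => h,
    fun _ => Metric.tendstoUniformlyOn_iff.2 fun _ hε =>
    .of_forall fun _ _ _ => by simpa using hε, fun _ => by simp, fun _ => by simp⟩

/-- Only continuity of w = K&L(x, u) is at stake: by graph boundedness its increments are controlled
by those of x, u and x', which are continuous. -/
theorem IsClassicalTrajectory.exists_extended (hKL : IsGraphBounded S KL) {x : ℝ → X} {u : ℝ → U}
    {y : ℝ → Y} (h : IsClassicalTrajectory S (Ici 0) x u y) :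
    ∃ w : ℝ → W, IsClassicalTrajectory (extendedNode S KL) (Ici 0) x u fun t => (y t, w t) := by
  classical
  obtain ⟨c, hc⟩ := hKL
  have hmem : ∀ t ∈ Ici (0 : ℝ), ∃ hz : (x t, u t) ∈ S.domain,
      S ⟨_, hz⟩ = (derivWithin x (Ici 0) t, y t) := by
    intro t ht
    obtain ⟨⟨z, hz⟩, hz1, hz2⟩ := (S.mem_graph_iff).1 (h.mem_graph t ht)
    obtain rfl : z = (x t, u t) := hz1
    exact ⟨hz, hz2⟩
  let w : ℝ → W := fun t => if ht : t ∈ Ici 0 then KL ⟨_, (hmem t ht).1⟩ else 0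
  have hw : ∀ t (ht : t ∈ Ici 0), w t = KL ⟨_, (hmem t ht).1⟩ := fun t ht => dif_pos ht
  have hx' : ContinuousOn (derivWithin x (Ici 0)) (Ici 0) :=
    h.state.continuousOn_derivWithin (uniqueDiffOn_Ici 0) le_rfl
  have hwc : ContinuousOn w (Ici 0) := by
    intro t ht
    refine tendsto_iff_norm_sub_tendsto_zero.2 (squeeze_zero' (.of_forall fun _ => norm_nonneg _)
      (g := fun τ => c * (‖(x τ, u τ) - (x t, u t)‖ +
        ‖derivWithin x (Ici 0) τ - derivWithin x (Ici 0) t‖)) ?_ ?_)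
    · filter_upwards [self_mem_nhdsWithin] with τ hτ
      rw [hw τ hτ, hw t ht, ← map_sub]
      refine (hc _).trans_eq ?_
      rw [LinearPMap.map_sub, (hmem τ hτ).2, (hmem t ht).2]
      rfl
    · have h1 := (h.state.continuousOn.prodMk h.input) t ht
      have h2 := hx' t ht
      have h3 := (((h1.sub_const (x t, u t)).norm.add
        (h2.sub_const (derivWithin x (Ici 0) t)).norm).const_mul c)
      simpa using h3
  refine ⟨w, h.state, h.input, h.output.prodMk hwc, fun t ht => ?_⟩
  exact mem_graph_extendedNode_iff.2 ⟨(hmem t ht).1, (hmem t ht).2, (hw t ht).symm⟩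

end Trajectories

/-! ### The dissipation balance and the dissipation output. -/

section Lure

variable {𝕜 X U Y W : Type*} [RCLike 𝕜]
  [NormedAddCommGroup X] [InnerProductSpace 𝕜 X] [NormedSpace ℝ X] [IsScalarTower ℝ 𝕜 X]
  [NormedAddCommGroup U] [InnerProductSpace 𝕜 U]
  [NormedAddCommGroup Y] [InnerProductSpace 𝕜 Y]
  [NormedAddCommGroup W] [InnerProductSpace 𝕜 W]
  {S : X × U →ₗ.[𝕜] X × Y} {KL : S.domain →ₗ[𝕜] W}

/-- The difference telescopes: ⟨Av, Bv⟩ - ⟨Aw, Bw⟩ = ⟨A(v - w), Bv⟩ + ⟨Aw, B(v - w)⟩. -/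
theorem abs_re_inner_sub_le {Z H : Type*} [NormedAddCommGroup Z] [NormedSpace 𝕜 Z]
    [NormedAddCommGroup H] [InnerProductSpace 𝕜 H] (A B : Z →L[𝕜] H) (v w : Z) :
    |RCLike.re ⟪A v, B v⟫_𝕜 - RCLike.re ⟪A w, B w⟫_𝕜| ≤
      (‖A‖ * ‖B‖) * (‖v - w‖ * (‖v‖ + ‖w‖)) := by
  have hs : RCLike.re ⟪A v, B v⟫_𝕜 - RCLike.re ⟪A w, B w⟫_𝕜 =
      RCLike.re (⟪A (v - w), B v⟫_𝕜 + ⟪A w, B (v - w)⟫_𝕜) := by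
    rw [← map_sub]
    congr 1
    simp only [map_sub, inner_sub_left, inner_sub_right]
    ring
  have hi : ∀ a b : Z, ‖⟪A a, B b⟫_𝕜‖ ≤ ‖A‖ * ‖B‖ * (‖a‖ * ‖b‖) := fun a b =>
    (norm_inner_le_norm _ _).trans ((mul_le_mul (A.le_opNorm a) (B.le_opNorm b) (norm_nonneg _)
      (by positivity)).trans_eq (by ring))
  rw [hs]
  calc _ ≤ ‖⟪A (v - w), B v⟫_𝕜 + ⟪A w, B (v - w)⟫_𝕜‖ := RCLike.abs_re_le_norm _
    _ ≤ _ := norm_add_le _ _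
    _ ≤ _ := add_le_add (hi _ _) (hi _ _)
    _ = _ := by ring

section SupplyRate

variable [CompleteSpace U] [CompleteSpace Y] (Q : Y →L[𝕜] Y) (N : U →L[𝕜] Y) (R : U →L[𝕜] U)

theorem exists_abs_supplyRate_sub_le : ∃ C : ℝ, ∀ v w : Y × U,
    |supplyRate Q N R v.1 v.2 - supplyRate Q N R w.1 w.2| ≤ C * (‖v - w‖ * (‖v‖ + ‖w‖)) := by
  let F : Y × U →L[𝕜] Y := ContinuousLinearMap.fst 𝕜 Y U
  let G : Y × U →L[𝕜] U := ContinuousLinearMap.snd 𝕜 Y U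
  let F' : Y × U →L[𝕜] Y := Q ∘L F + N ∘L G
  let G' : Y × U →L[𝕜] U := ContinuousLinearMap.adjoint N ∘L F + R ∘L G
  refine ⟨‖F‖ * ‖F'‖ + ‖G‖ * ‖G'‖, fun v w => ?_⟩
  have hs : ∀ v : Y × U, supplyRate Q N R v.1 v.2 =
      RCLike.re ⟪F v, F' v⟫_𝕜 + RCLike.re ⟪G v, G' v⟫_𝕜 := fun v => map_add _ _ _
  rw [hs, hs, add_sub_add_comm, add_mul]
  exact (abs_add_le _ _).trans
    (add_le_add (abs_re_inner_sub_le F F' v w) (abs_re_inner_sub_le G G' v w))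

@[simp]
theorem supplyRate_zero : supplyRate Q N R 0 0 = 0 := by simp [supplyRate]

end SupplyRate

/-- Symmetry of P makes the two terms of the product rule have equal real parts. -/
theorem hasDerivWithinAt_re_inner {P : X →L[𝕜] X} (hP : (P : X →ₗ[𝕜] X).IsSymmetric) {x : ℝ → X}
    {x' : X} {I : Set ℝ} {t : ℝ} (hx : HasDerivWithinAt x x' I t) :
    HasDerivWithinAt (fun τ => RCLike.re ⟪x τ, P (x τ)⟫_𝕜) (2 * RCLike.re ⟪P (x t), x'⟫_𝕜) I t := by
  have hPx : HasDerivWithinAt (fun τ => P (x τ)) (P x') I t :=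
    (P.restrictScalars ℝ).hasFDerivAt.comp_hasDerivWithinAt t hx
  have h := (RCLike.reCLM (K := 𝕜)).hasFDerivAt.comp_hasDerivWithinAt t (hx.inner 𝕜 hPx)
  refine h.congr_deriv ?_
  have h1 : ⟪x t, P x'⟫_𝕜 = ⟪P (x t), x'⟫_𝕜 := (hP (x t) x').symm
  have h2 : RCLike.re ⟪x', P (x t)⟫_𝕜 = RCLike.re ⟪P (x t), x'⟫_𝕜 := inner_re_symm _ _
  rw [RCLike.reCLM_apply, map_add, h1, h2, two_mul]

/-- The dissipation balance along classical trajectories. -/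
theorem IsClassicalTrajectory.integral_sq_eq {s : Y → U → ℝ} {C : ℝ}
    (hs : ∀ v w : Y × U, |s v.1 v.2 - s w.1 w.2| ≤ C * (‖v - w‖ * (‖v‖ + ‖w‖)))
    {P : X →L[𝕜] X} (hP : (P : X →ₗ[𝕜] X).IsSymmetric) (hLure : LureEquation S s P KL)
    {x : ℝ → X} {u : ℝ → U} {p : ℝ → Y × W}
    (h : IsClassicalTrajectory (extendedNode S KL) (Ici 0) x u p) {t : ℝ} (ht : 0 ≤ t) :
    ∫ τ in (0 : ℝ)..t, ‖(p τ).2‖ ^ 2 = RCLike.re ⟪x t, P (x t)⟫_𝕜 - RCLike.re ⟪x 0, P (x 0)⟫_𝕜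
      + ∫ τ in (0 : ℝ)..t, s (p τ).1 (u τ) := by
  have hsub : Icc 0 t ⊆ Ici 0 := Icc_subset_Ici_self
  have hp1 : ContinuousOn (fun τ => (p τ).1) (Ici 0) := h.output.fst
  have hp2 : ContinuousOn (fun τ => (p τ).2) (Ici 0) := h.output.snd
  have hsc : ContinuousOn (fun τ => s (p τ).1 (u τ)) (Ici 0) :=
    (continuous_of_quadratic (b := fun v : Y × U => s v.1 v.2) hs).comp_continuousOn
      (hp1.prodMk h.input)
  have hwc : ContinuousOn (fun τ => ‖(p τ).2‖ ^ 2) (Ici 0) := hp2.norm.pow 2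
  have hs_int : IntervalIntegrable (fun τ => s (p τ).1 (u τ)) volume 0 t :=
    (hsc.mono hsub).intervalIntegrable_of_Icc ht
  have hw_int : IntervalIntegrable (fun τ => ‖(p τ).2‖ ^ 2) volume 0 t :=
    (hwc.mono hsub).intervalIntegrable_of_Icc ht
  have hd : ∀ τ ∈ Ici (0 : ℝ), HasDerivWithinAt (fun τ => RCLike.re ⟪x τ, P (x τ)⟫_𝕜)
      (‖(p τ).2‖ ^ 2 - s (p τ).1 (u τ)) (Ici 0) τ := by
    intro τ hτ
    have hx := (h.state.differentiableOn one_ne_zero τ hτ).hasDerivWithinAt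
    refine (hasDerivWithinAt_re_inner hP hx).congr_deriv ?_
    obtain ⟨hz, h1, h2⟩ := mem_graph_extendedNode_iff.1 (h.mem_graph τ hτ)
    have := hLure ⟨_, hz⟩
    rw [h1, h2] at this
    exact eq_sub_of_add_eq this
  rw [← sub_eq_iff_eq_add, ← intervalIntegral.integral_sub hw_int hs_int]
  refine intervalIntegral.integral_eq_sub_of_hasDerivAt_of_le ht
    (fun τ hτ => ((hd τ (hsub hτ)).continuousWithinAt).mono hsub)
    (fun τ hτ => (hd τ hτ.1.le).hasDerivAt (Ici_mem_nhds hτ.1)) (hw_int.sub hs_int)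

/-- If states, inputs and outputs of classical trajectories tend to zero, so do the dissipation
outputs. -/
theorem tendsto_dissipationOutput_zero {s : Y → U → ℝ} {C : ℝ}
    (hs : ∀ v w : Y × U, |s v.1 v.2 - s w.1 w.2| ≤ C * (‖v - w‖ * (‖v‖ + ‖w‖)))
    (hs0 : s 0 0 = 0) {P : X →L[𝕜] X} (hP : (P : X →ₗ[𝕜] X).IsSymmetric)
    (hLure : LureEquation S s P KL) {ι : Type*} {l : Filter ι}
    {x : ι → ℝ → X} {u : ι → ℝ → U} {p : ι → ℝ → Y × W}
    (h : ∀ i, IsClassicalTrajectory (extendedNode S KL) (Ici 0) (x i) (u i) (p i))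
    {t : ℝ} (ht : 0 ≤ t) (hxt : Tendsto (fun i => x i t) l (𝓝 0))
    (hx0 : Tendsto (fun i => x i 0) l (𝓝 0))
    (hu : Tendsto (fun i => eLpNorm (u i) 2 (volume.restrict (Icc 0 t))) l (𝓝 0))
    (hy : Tendsto (fun i => eLpNorm (fun τ => (p i τ).1) 2 (volume.restrict (Icc 0 t))) l (𝓝 0)) :
    Tendsto (fun i => eLpNorm (fun τ => (p i τ).2) 2 (volume.restrict (Icc 0 t))) l (𝓝 0) := by
  rw [tendsto_eLpNorm_two_zero_iff fun i => (h i).output.memL2Loc.snd t]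
  simp_rw [← intervalIntegral_eq_integral_Icc ht, (h _).integral_sq_eq hs hP hLure ht,
    intervalIntegral_eq_integral_Icc ht]
  have hV : Continuous fun v : X => RCLike.re ⟪v, P v⟫_𝕜 := by fun_prop
  have h1 := (hV.tendsto 0).comp hxt
  have h2 := (hV.tendsto 0).comp hx0
  have hmem : ∀ i, MemLp (fun τ => ((p i τ).1, u i τ)) 2 (volume.restrict (Icc 0 t)) :=
    fun i => ((h i).output.memL2Loc.fst.prodMk (h i).input.memL2Loc) t
  -- The remaining term of the balance is the integral of s, whose L² limit point is the zero
  -- function.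
  have h3 := tendsto_integral_of_quadratic (b := fun v : Y × U => s v.1 v.2) (l := l)
    hs hs0 hmem (g := 0) MemLp.zero (by
      refine tendsto_of_tendsto_of_tendsto_of_le_of_le tendsto_const_nhds
        (by simpa only [add_zero] using hy.add hu) (fun _ => zero_le) fun i => ?_
      rw [sub_zero]
      exact eLpNorm_prod_le one_le_two ((h i).output.memL2Loc.fst t).1
        ((h i).input.memL2Loc t).1)
  simpa [Function.comp_def, hs0] using (h1.sub h2).add h3

/-- The dissipation outputs of two sequences of classical trajectories approximating the same
generalized trajectory approach each other. -/
theorem tendsto_dissipationOutput_sub {s : Y → U → ℝ} {C : ℝ}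
    (hs : ∀ v w : Y × U, |s v.1 v.2 - s w.1 w.2| ≤ C * (‖v - w‖ * (‖v‖ + ‖w‖)))
    (hs0 : s 0 0 = 0) {P : X →L[𝕜] X} (hP : (P : X →ₗ[𝕜] X).IsSymmetric)
    (hLure : LureEquation S s P KL)
    {x : ℝ → X} {u : ℝ → U} {y : ℝ → Y} (hu : MemL2Loc u) (hy : MemL2Loc y)
    {xk xk' : ℕ → ℝ → X} {uk uk' : ℕ → ℝ → U} {pk pk' : ℕ → ℝ → Y × W}
    (h : ∀ i, IsClassicalTrajectory (extendedNode S KL) (Ici 0) (xk i) (uk i) (pk i))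
    (h' : ∀ i, IsClassicalTrajectory (extendedNode S KL) (Ici 0) (xk' i) (uk' i) (pk' i))
    (hx : ∀ t, 0 ≤ t → Tendsto (fun i => xk i t) atTop (𝓝 (x t)))
    (hx' : ∀ t, 0 ≤ t → Tendsto (fun i => xk' i t) atTop (𝓝 (x t)))
    (huk : TendstoL2Loc uk u) (huk' : TendstoL2Loc uk' u)
    (hyk : TendstoL2Loc (fun k τ => (pk k τ).1) y) (hyk' : TendstoL2Loc (fun k τ => (pk' k τ).1) y)
    {t : ℝ} (ht : 0 ≤ t) :
    Tendsto (fun i : ℕ × ℕ => eLpNorm (fun τ => (pk i.1 τ).2 - (pk' i.2 τ).2) 2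
      (volume.restrict (Icc 0 t))) atTop (𝓝 0) := by
  rw [← prod_atTop_atTop_eq]
  have hxd : ∀ τ, 0 ≤ τ →
      Tendsto (fun i : ℕ × ℕ => (xk i.1 - xk' i.2) τ) (atTop ×ˢ atTop) (𝓝 0) := fun τ hτ => by
    simpa using ((hx τ hτ).comp tendsto_fst).sub ((hx' τ hτ).comp (tendsto_snd (f := atTop)))
  have hud := tendsto_eLpNorm_sub_sub one_le_two (fun i => ((h i).input.memL2Loc t).1)
    (fun i => ((h' i).input.memL2Loc t).1) (hu t).1 (huk t) (huk' t)
  have hyd := tendsto_eLpNorm_sub_sub one_le_two (fun i => ((h i).output.memL2Loc.fst t).1)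
    (fun i => ((h' i).output.memL2Loc.fst t).1) (hy t).1 (hyk t) (hyk' t)
  have hcl : ∀ i : ℕ × ℕ, IsClassicalTrajectory (extendedNode S KL) (Ici 0)
      (xk i.1 - xk' i.2) (uk i.1 - uk' i.2) (pk i.1 - pk' i.2) := fun i => (h i.1).sub (h' i.2)
  exact tendsto_dissipationOutput_zero hs hs0 hP hLure hcl ht (hxd t ht) (hxd 0 le_rfl) hud hyd

/-- Classical approximants have dissipation outputs; comparing the sequence with itself shows that
these are Cauchy on every [0, t]. -/
theorem IsGeneralizedTrajectory.exists_dissipationOutput [CompleteSpace W] {s : Y → U → ℝ} {C : ℝ}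
    (hs : ∀ v w : Y × U, |s v.1 v.2 - s w.1 w.2| ≤ C * (‖v - w‖ * (‖v‖ + ‖w‖)))
    (hs0 : s 0 0 = 0) {P : X →L[𝕜] X} (hP : (P : X →ₗ[𝕜] X).IsSymmetric)
    (hLure : LureEquation S s P KL) (hKL : IsGraphBounded S KL)
    {x : ℝ → X} {u : ℝ → U} {y : ℝ → Y} (h : IsGeneralizedTrajectory S x u y) :
    ∃ w : ℝ → W, IsDissipationOutput S KL x u y w := by
  obtain ⟨xk, uk, yk, hk, hx, hu, hy⟩ := h.approx
  choose wk hwk using fun k => (hk k).exists_extended hKL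
  have hx' : ∀ t, 0 ≤ t → Tendsto (fun i => xk i t) atTop (𝓝 (x t)) := fun t ht =>
    (hx t).tendsto_at ⟨ht, le_rfl⟩
  have hwl : ∀ k, MemL2Loc (wk k) := fun k => (hwk k).output.memL2Loc.snd
  obtain ⟨w, hw, hwt⟩ := exists_tendstoL2Loc hwl fun t ht =>
    tendsto_dissipationOutput_sub hs hs0 hP hLure h.input h.output hwk hwk hx' hx' hu hu hy hy ht
  exact ⟨w, h.state, h.input, h.output.prodMk hw, xk, uk, _, hwk, hx, hu,
    hy.prodMk (fun k => (hk k).output.memL2Loc) hwl h.output hw hwt⟩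

theorem IsDissipationOutput.ae_eq {s : Y → U → ℝ} {C : ℝ}
    (hs : ∀ v w : Y × U, |s v.1 v.2 - s w.1 w.2| ≤ C * (‖v - w‖ * (‖v‖ + ‖w‖)))
    (hs0 : s 0 0 = 0) {P : X →L[𝕜] X} (hP : (P : X →ₗ[𝕜] X).IsSymmetric)
    (hLure : LureEquation S s P KL)
    {x : ℝ → X} {u : ℝ → U} {y : ℝ → Y} {w w' : ℝ → W} (h : IsDissipationOutput S KL x u y w)
    (h' : IsDissipationOutput S KL x u y w') : w =ᵐ[volume.restrict (Ici 0)] w' := by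
  obtain ⟨xk, uk, pk, hk, hx, hu, hp⟩ := h.approx
  obtain ⟨xk', uk', pk', hk', hx', hu', hp'⟩ := h'.approx
  have hw := h.output.snd
  have hw' := h'.output.snd
  have key : ∀ n : ℕ, w =ᵐ[volume.restrict (Icc (0 : ℝ) n)] w' := by
    intro n
    have hsub := tendsto_dissipationOutput_sub hs hs0 hP hLure h.input h.output.fst hk hk'
      (fun t ht => (hx t).tendsto_at ⟨ht, le_rfl⟩) (fun t ht => (hx' t).tendsto_at ⟨ht, le_rfl⟩)
      hu hu' hp.fst hp'.fst n.cast_nonneg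
    -- On the diagonal the two sequences of dissipation outputs approach each other, so the first
    -- one also converges to `w'`.
    have hdiag := hsub.comp tendsto_atTop_diagonal
    have hpm := fun k => (hk k).output.memL2Loc.snd
    have hpm' := fun k => (hk' k).output.memL2Loc.snd
    refine ae_eq_of_tendsto_eLpNorm one_le_two (fun k => (hpm k n).1) (hw n).1 (hw' n).1
      (hp.snd n) ?_
    refine tendsto_of_tendsto_of_tendsto_of_le_of_le tendsto_const_nhds
      (by simpa only [add_zero] using hdiag.add (hp'.snd n)) (fun _ => zero_le) fun k => ?_
    have := eLpNorm_add_le ((hpm k n).1.sub (hpm' k n).1) ((hpm' k n).1.sub (hw' n).1) one_le_two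
    rwa [sub_add_sub_cancel] at this
  have hU : Ici (0 : ℝ) = ⋃ n : ℕ, Icc (0 : ℝ) n := by
    ext t
    simpa using fun _ => exists_nat_ge t
  rw [hU, EventuallyEq, ae_restrict_iUnion_iff]
  exact key

/-- The dissipation balance along generalized trajectories. -/
theorem IsDissipationOutput.integral_sq_eq {s : Y → U → ℝ} {C : ℝ}
    (hs : ∀ v w : Y × U, |s v.1 v.2 - s w.1 w.2| ≤ C * (‖v - w‖ * (‖v‖ + ‖w‖)))
    (hs0 : s 0 0 = 0) {P : X →L[𝕜] X} (hP : (P : X →ₗ[𝕜] X).IsSymmetric)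
    (hLure : LureEquation S s P KL)
    {x : ℝ → X} {u : ℝ → U} {y : ℝ → Y} {w : ℝ → W} (h : IsDissipationOutput S KL x u y w)
    {t : ℝ} (ht : 0 ≤ t) :
    ∫ τ in (0 : ℝ)..t, ‖w τ‖ ^ 2 = RCLike.re ⟪x t, P (x t)⟫_𝕜 - RCLike.re ⟪x 0, P (x 0)⟫_𝕜
      + ∫ τ in (0 : ℝ)..t, s (y τ) (u τ) := by
  obtain ⟨xk, uk, pk, hk, hx, hu, hp⟩ := h.approx
  have hV : Continuous fun v : X => RCLike.re ⟪v, P v⟫_𝕜 := by fun_prop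
  have h1 := tendsto_intervalIntegral_of_quadratic abs_norm_sq_sub_le (by simp)
    (fun k => (hk k).output.memL2Loc.snd) h.output.snd hp.snd ht
  have hpm := fun k => (hk k).output.memL2Loc.fst
  have h2 := tendsto_intervalIntegral_of_quadratic (b := fun v : Y × U => s v.1 v.2) hs hs0
    (fun k => (hpm k).prodMk (hk k).input.memL2Loc) (h.output.fst.prodMk h.input)
    (hp.fst.prodMk hpm (fun k => (hk k).input.memL2Loc) h.output.fst h.input hu) ht
  have h3 := (hV.tendsto _).comp ((hx t).tendsto_at ⟨ht, le_rfl⟩)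
  have h4 := (hV.tendsto _).comp ((hx t).tendsto_at ⟨le_rfl, ht⟩)
  refine tendsto_nhds_unique h1 (((h3.sub h4).add h2).congr fun k => ?_)
  exact ((hk k).integral_sq_eq hs hP hLure ht).symm

/-- The balance on [0, n] has a limit because the storage at time n vanishes. The integrals of ‖w‖²
increase with time, so this limit bounds them all and gives square integrability. -/
theorem IsDissipationOutput.memL2_and_integral_eq {s : Y → U → ℝ} {C : ℝ}
    (hs : ∀ v w : Y × U, |s v.1 v.2 - s w.1 w.2| ≤ C * (‖v - w‖ * (‖v‖ + ‖w‖)))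
    (hs0 : s 0 0 = 0) {P : X →L[𝕜] X} (hP : (P : X →ₗ[𝕜] X).IsSymmetric)
    (hLure : LureEquation S s P KL)
    {x : ℝ → X} {u : ℝ → U} {y : ℝ → Y} {w : ℝ → W} (h : IsDissipationOutput S KL x u y w)
    (hint : IntegrableOn (fun τ => s (y τ) (u τ)) (Ici 0)) (hx : Tendsto x atTop (𝓝 0)) :
    MemL2 w ∧ ∫ τ in Ici (0 : ℝ), ‖w τ‖ ^ 2 =
      -RCLike.re ⟪x 0, P (x 0)⟫_𝕜 + ∫ τ in Ici (0 : ℝ), s (y τ) (u τ) := by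
  have hV : Continuous fun v : X => RCLike.re ⟪v, P v⟫_𝕜 := by fun_prop
  have hlim : Tendsto (fun n : ℕ => ∫ τ in (0 : ℝ)..n, ‖w τ‖ ^ 2) atTop
      (𝓝 (-RCLike.re ⟪x 0, P (x 0)⟫_𝕜 + ∫ τ in Ici (0 : ℝ), s (y τ) (u τ))) := by
    have h1 := (hV.tendsto 0).comp (hx.comp tendsto_natCast_atTop_atTop)
    have h2 := intervalIntegral_tendsto_integral_Ioi 0
      (hint.mono_set Ioi_subset_Ici_self) tendsto_natCast_atTop_atTop
    have h3 := (h1.sub_const (RCLike.re ⟪x 0, P (x 0)⟫_𝕜)).add h2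
    rw [integral_Ici_eq_integral_Ioi]
    simp only [inner_zero_left, map_zero, zero_sub] at h3
    exact h3.congr fun n => (h.integral_sq_eq hs hs0 hP hLure n.cast_nonneg).symm
  have hw := h.output.snd
  have hmono : ∀ {a b : ℝ}, 0 ≤ a → a ≤ b →
      ∫ τ in (0 : ℝ)..a, ‖w τ‖ ^ 2 ≤ ∫ τ in (0 : ℝ)..b, ‖w τ‖ ^ 2 := by
    intro a b ha hab
    rw [intervalIntegral_eq_integral_Icc ha, intervalIntegral_eq_integral_Icc (ha.trans hab)]
    exact setIntegral_mono_set ((memLp_two_iff_integrable_sq_norm (hw b).1).1 (hw b))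
      (ae_of_all _ fun _ => by positivity) (Icc_subset_Icc_right hab).eventuallyLE
  have hmem : MemL2 w := by
    refine hw.memL2_of_bounded fun t ht => ge_of_tendsto hlim ?_
    filter_upwards [eventually_ge_atTop ⌈t⌉₊] with n hn
    exact hmono ht.le (Nat.ceil_le.1 hn)
  refine ⟨hmem, tendsto_nhds_unique ?_ hlim⟩
  rw [integral_Ici_eq_integral_Ioi]
  exact intervalIntegral_tendsto_integral_Ioi 0
    (((memLp_two_iff_integrable_sq_norm hmem.1).1 hmem).mono_measure
      (Measure.restrict_mono Ioi_subset_Ici_self le_rfl)) tendsto_natCast_atTop_atTop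

end Lure

/-! ### Strongly continuous semigroups and their generators. -/

section Semigroups

variable {𝕜 X : Type*} [RCLike 𝕜] [NormedAddCommGroup X] [NormedSpace 𝕜 X]
  {T : ℝ → X →L[𝕜] X} {A : X →ₗ.[𝕜] X}

/-- The orbit of `x`, extended to negative times by the constant `T 0 x`, is continuous. -/
theorem IsC0Semigroup.continuous_orbit_max (hT : IsC0Semigroup T) (x : X) :
    Continuous fun t => T (max t 0) x :=
  (hT.continuousOn x).comp_continuous (continuous_id.max continuous_const)
    fun t => le_max_right t 0

theorem IsC0Semigroup.exists_norm_le [CompleteSpace X] (hT : IsC0Semigroup T) (b : ℝ) :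
    ∃ C, ∀ t ∈ Icc 0 b, ‖T t‖ ≤ C := by
  obtain ⟨C, hC⟩ := banach_steinhaus (g := fun t : Icc (0 : ℝ) b => T t) fun x => by
    obtain ⟨C, hC⟩ := isCompact_Icc.exists_bound_of_continuousOn
      ((hT.continuousOn x).mono fun t (ht : t ∈ Icc 0 b) => ht.1)
    exact ⟨C, fun t => hC t t.2⟩
  exact ⟨C, fun t ht => hC ⟨t, ht⟩⟩

theorem IsC0Semigroup.hasDerivWithinAt_integral [NormedSpace ℝ X] [CompleteSpace X]
    (hT : IsC0Semigroup T) (y : X)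
    {t : ℝ} (ht : 0 ≤ t) :
    HasDerivWithinAt (fun r => ∫ τ in (0 : ℝ)..r, T τ y) (T t y) (Ici 0) t := by
  have hc := hT.continuous_orbit_max y
  have h := (intervalIntegral.integral_hasDerivAt_right (hc.intervalIntegrable 0 t)
    hc.stronglyMeasurable.stronglyMeasurableAtFilter hc.continuousAt).hasDerivWithinAt (s := Ici 0)
  rw [max_eq_left ht] at h
  have hcongr : ∀ r ∈ Ici (0 : ℝ),
      ∫ τ in (0 : ℝ)..r, T τ y = ∫ τ in (0 : ℝ)..r, T (max τ 0) y := fun r hr =>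
    intervalIntegral.integral_congr fun τ hτ => by
      rw [uIcc_of_le hr] at hτ
      simp only [max_eq_left hτ.1]
  exact h.congr hcongr (hcongr t ht)

/-- T(r) shifts the integral to [r, r + t], so its difference quotient is that of r ↦ ∫₀^{r+t} -
∫₀^r, with right derivative T(t)x - x at 0. -/
theorem IsGenerator.integral_mem_domain [NormedSpace ℝ X] [CompleteSpace X]
    (hT : IsC0Semigroup T) (hA : IsGenerator A T) (x : X) {t : ℝ} (ht : 0 ≤ t) :
    ∃ y, (∫ τ in (0 : ℝ)..t, T τ x, y) ∈ A.graph := by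
  refine ⟨T t x - x, (hA _ _).2 ?_⟩
  have hi : ∀ a b : ℝ, 0 ≤ a → 0 ≤ b → IntervalIntegrable (fun τ => T τ x) volume a b :=
    fun a b ha hb => ((hT.continuousOn x).mono fun τ hτ =>
      (le_min ha hb).trans hτ.1).intervalIntegrable
  have hF : ∀ {a : ℝ}, 0 ≤ a →
      HasDerivWithinAt (fun r => ∫ τ in (0 : ℝ)..(r + a), T τ x) (T a x) (Ioi 0) 0 := by
    intro a ha
    have h1 := hT.hasDerivWithinAt_integral x ha
    rw [← zero_add a] at h1
    have h2 := h1.scomp (h := fun r : ℝ => r + a) (s := Ioi 0) 0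
      ((hasDerivWithinAt_id (0 : ℝ) (Ioi 0)).add_const a)
      fun r hr => add_nonneg (le_of_lt hr) ha
    simpa [Function.comp_def] using h2
  have h3 := (hF ht).sub (hF le_rfl)
  rw [hasDerivWithinAt_iff_tendsto_slope' self_notMem_Ioi, hT.map_zero] at h3
  refine h3.congr' ?_
  filter_upwards [self_mem_nhdsWithin] with r hr
  have hr' : 0 ≤ r := le_of_lt hr
  have h4 : T r (∫ τ in (0 : ℝ)..t, T τ x) = ∫ τ in r..(r + t), T τ x := by
    rw [← ContinuousLinearMap.intervalIntegral_comp_comm (T r) (hi 0 t le_rfl ht)]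
    have h5 := intervalIntegral.integral_comp_add_right (a := 0) (b := t) (fun τ => T τ x) r
    rw [zero_add, add_comm t r] at h5
    rw [← h5]
    refine intervalIntegral.integral_congr fun τ hτ => ?_
    rw [uIcc_of_le ht] at hτ
    rw [add_comm τ r, hT.map_add r τ hr' hτ.1, ContinuousLinearMap.comp_apply]
  rw [slope_def_module, h4, ← intervalIntegral.integral_interval_sub_left
    (hi 0 (r + t) le_rfl (by positivity)) (hi 0 r le_rfl hr')]
  simp [sub_right_comm]

variable [NormedSpace ℝ X] [IsScalarTower ℝ 𝕜 X]

theorem IsGenerator.apply_mem_graph (hT : IsC0Semigroup T) (hA : IsGenerator A T) {x y : X}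
    (h : (x, y) ∈ A.graph) {t : ℝ} (ht : 0 ≤ t) : (T t x, T t y) ∈ A.graph := by
  refine (hA _ _).2 ((((T t).continuous.tendsto y).comp ((hA x y).1 h)).congr' ?_)
  filter_upwards [self_mem_nhdsWithin] with r hr
  have h1 : T r (T t x) = T t (T r x) := by
    rw [← ContinuousLinearMap.comp_apply, ← ContinuousLinearMap.comp_apply,
      ← hT.map_add r t (le_of_lt hr) ht, ← hT.map_add t r ht (le_of_lt hr), add_comm]
  simp [h1]

theorem IsGenerator.hasDerivWithinAt_Ioi (hT : IsC0Semigroup T) (hA : IsGenerator A T) {x y : X}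
    (h : (x, y) ∈ A.graph) {t : ℝ} (ht : 0 ≤ t) :
    HasDerivWithinAt (fun τ => T τ x) (T t y) (Ioi t) t := by
  rw [hasDerivWithinAt_iff_tendsto_slope' self_notMem_Ioi]
  have h1 := (hA _ _).1 (hA.apply_mem_graph hT h ht)
  have h2 : Tendsto (fun τ => τ - t) (𝓝[>] t) (𝓝[>] 0) := by
    refine tendsto_nhdsWithin_of_tendsto_nhds_of_eventually_within _ ?_ ?_
    · exact (Continuous.tendsto' (f := fun τ => τ - t) (by fun_prop) t 0
        (sub_self t)).mono_left nhdsWithin_le_nhds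
    · filter_upwards [self_mem_nhdsWithin] with τ hτ using sub_pos.2 (mem_Ioi.1 hτ)
  refine (h1.comp h2).congr' ?_
  filter_upwards [self_mem_nhdsWithin] with τ hτ
  have h3 : T τ x = T (τ - t) (T t x) := by
    rw [← ContinuousLinearMap.comp_apply, ← hT.map_add _ _ (sub_nonneg.2 (le_of_lt hτ)) ht,
      sub_add_cancel]
  rw [slope_def_module, h3]
  rfl

/-- The definition of the generator gives only right derivatives of orbits; together with continuity
they suffice for the fundamental theorem of calculus. The integral formula then upgrades them to
derivatives within the half-line. -/
theorem IsGenerator.integral_eq [CompleteSpace X] (hT : IsC0Semigroup T) (hA : IsGenerator A T)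
    {x y : X} (h : (x, y) ∈ A.graph) {t : ℝ} (ht : 0 ≤ t) :
    ∫ τ in (0 : ℝ)..t, T τ y = T t x - x := by
  have h0 : T 0 x = x := by rw [hT.map_zero]; rfl
  conv_rhs => rw [← h0, hT.map_zero]
  rw [intervalIntegral.integral_eq_sub_of_hasDeriv_right_of_le ht
    ((hT.continuousOn x).mono Icc_subset_Ici_self)
    (fun τ hτ => hA.hasDerivWithinAt_Ioi hT h hτ.1.le)
    (((hT.continuousOn y).mono Icc_subset_Ici_self).intervalIntegrable_of_Icc ht), hT.map_zero]
  simp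

theorem IsGenerator.hasDerivWithinAt [CompleteSpace X] (hT : IsC0Semigroup T)
    (hA : IsGenerator A T) {x y : X} (h : (x, y) ∈ A.graph) {t : ℝ} (ht : 0 ≤ t) :
    HasDerivWithinAt (fun τ => T τ x) (T t y) (Ici 0) t := by
  have heq : ∀ τ ∈ Ici (0 : ℝ), T τ x = (∫ r in (0 : ℝ)..τ, T r y) + x := fun τ hτ => by
    rw [hA.integral_eq hT h hτ, sub_add_cancel]
  exact ((hT.hasDerivWithinAt_integral y ht).add_const x).congr heq (heq t ht)

theorem IsGenerator.contDiffOn [CompleteSpace X] (hT : IsC0Semigroup T)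
    (hA : IsGenerator A T) {x y : X} (h : (x, y) ∈ A.graph) :
    ContDiffOn ℝ 1 (fun τ => T τ x) (Ici 0) := by
  rw [show (1 : WithTop ℕ∞) = 0 + 1 by simp,
    contDiffOn_succ_iff_derivWithin (uniqueDiffOn_Ici 0)]
  refine ⟨fun t ht => (hA.hasDerivWithinAt hT h ht).differentiableWithinAt, by simp, ?_⟩
  rw [contDiffOn_zero]
  exact (hT.continuousOn y).congr fun t ht =>
    (hA.hasDerivWithinAt hT h ht).derivWithin (uniqueDiffOn_Ici 0 t ht)

/-- The integrated equation ∫₀ᵗ T(τ)y dτ = T(t)x - x survives limits by uniform boundedness on [0,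
t]; dividing by t recovers membership in the graph. -/
theorem IsGenerator.isClosed [CompleteSpace X] (hT : IsC0Semigroup T) (hA : IsGenerator A T) :
    A.IsClosed := by
  refine IsSeqClosed.isClosed fun z p hz hp => ?_
  obtain ⟨x, y⟩ := p
  have hx : Tendsto (fun n => (z n).1) atTop (𝓝 x) := hp.fst_nhds
  have hy : Tendsto (fun n => (z n).2) atTop (𝓝 y) := hp.snd_nhds
  have hint : ∀ t, 0 ≤ t → ∫ τ in (0 : ℝ)..t, T τ y = T t x - x := by
    intro t ht
    obtain ⟨C, hC⟩ := hT.exists_norm_le t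
    have h1 : Tendsto (fun n => T t (z n).1 - (z n).1) atTop (𝓝 (T t x - x)) :=
      (((T t).continuous.tendsto x).comp hx).sub hx
    refine tendsto_nhds_unique (f := fun n => ∫ τ in (0 : ℝ)..t, T τ (z n).2) ?_
      (h1.congr fun n => (hA.integral_eq hT (hz n) ht).symm)
    have hi : ∀ v : X, IntervalIntegrable (fun τ => T τ v) volume 0 t := fun v =>
      ((hT.continuousOn v).mono Icc_subset_Ici_self).intervalIntegrable_of_Icc ht
    refine tendsto_iff_norm_sub_tendsto_zero.2 (squeeze_zero (fun _ => norm_nonneg _)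
      (g := fun n => C * ‖(z n).2 - y‖ * |t - 0|) (fun n => ?_) ?_)
    · rw [← intervalIntegral.integral_sub (hi _) (hi _)]
      refine intervalIntegral.norm_integral_le_of_norm_le_const fun τ hτ => ?_
      rw [uIoc_of_le ht] at hτ
      rw [← map_sub]
      exact (T τ).le_of_opNorm_le (hC τ (Ioc_subset_Icc_self hτ)) _
    · simpa using ((hy.sub_const y).norm.const_mul C).mul_const |t - 0|
  refine (hA x y).2 ?_
  have h2 := (hT.hasDerivWithinAt_integral y le_rfl).mono (Ioi_subset_Ici_self)
  rw [hasDerivWithinAt_iff_tendsto_slope' self_notMem_Ioi, hT.map_zero] at h2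
  refine h2.congr' ?_
  filter_upwards [self_mem_nhdsWithin] with t ht
  rw [slope_def_module, hint t (le_of_lt ht)]
  simp

/-- The averages t⁻¹ ∫₀ᵗ T(τ)x dτ lie in the domain and converge to x. -/
theorem IsGenerator.dense_domain [CompleteSpace X] (hT : IsC0Semigroup T) (hA : IsGenerator A T) :
    Dense (A.domain : Set X) := by
  intro x
  have h := (hT.hasDerivWithinAt_integral x le_rfl).mono (Ioi_subset_Ici_self)
  rw [hasDerivWithinAt_iff_tendsto_slope' self_notMem_Ioi, hT.map_zero] at h
  refine mem_closure_of_tendsto h ?_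
  filter_upwards [self_mem_nhdsWithin] with t ht
  obtain ⟨y, hy⟩ := hA.integral_mem_domain hT x (le_of_lt ht)
  rw [slope_def_module, intervalIntegral.integral_same, sub_zero, sub_zero, SetLike.mem_coe,
    ← algebraMap_smul 𝕜 t⁻¹]
  exact A.domain.smul_mem _ (LinearPMap.mem_domain_of_mem_graph hy)

end Semigroups

/-! ### Semigroup orbits as trajectories of a system node. -/

section Nodes

variable {𝕜 X U Y Z : Type*} [RCLike 𝕜]
  [NormedAddCommGroup X] [NormedSpace 𝕜 X]
  [NormedAddCommGroup U] [NormedSpace 𝕜 U]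
  [NormedAddCommGroup Y] [NormedSpace 𝕜 Y]
  [NormedAddCommGroup Z] [NormedSpace 𝕜 Z]
  {S : X × U →ₗ.[𝕜] X × Y} {T : ℝ → X →L[𝕜] X}

theorem mem_graph_mainOperator_iff {x x' : X} :
    (x, x') ∈ (mainOperator S).graph ↔ ∃ y, ((x, 0), (x', y)) ∈ S.graph := by
  simp only [LinearPMap.mem_graph_iff]
  constructor
  · rintro ⟨⟨v, hv⟩, rfl, h⟩
    exact ⟨(S ⟨(v, 0), hv⟩).2, ⟨(v, 0), hv⟩, rfl, Prod.ext h rfl⟩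
  · rintro ⟨y, ⟨v, hv⟩, h1, h2⟩
    obtain rfl : v = (x, 0) := h1
    exact ⟨⟨x, hv⟩, rfl, congrArg Prod.fst h2⟩

/-- The observation operator `x ↦ C&D (x, 0)` is bounded with respect to the graph norm of the main
operator. -/
theorem exists_observation [CompleteSpace X] [CompleteSpace Y] (hS : S.IsClosed)
    (hA : (mainOperator S).IsClosed) :
    ∃ C : (mainOperator S).graph →L[𝕜] Y,
      ∀ z : (mainOperator S).graph, (((z : X × X).1, (0 : U)), ((z : X × X).2, C z)) ∈ S.graph := by
  choose f hf using fun z : (mainOperator S).graph => mem_graph_mainOperator_iff.1 z.2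
  have huniq : ∀ {x : X × U} {x' : X} {y y' : Y}, (x, (x', y)) ∈ S.graph →
      (x, (x', y')) ∈ S.graph → y = y' := fun h h' =>
    congrArg Prod.snd (S.mem_graph_snd_inj h h' rfl)
  let C : (mainOperator S).graph →ₗ[𝕜] Y :=
    { toFun := f
      map_add' := fun z w => huniq (hf (z + w)) (by
        simpa using S.graph.add_mem (hf z) (hf w))
      map_smul' := fun c z => huniq (hf (c • z)) (by
        simpa using S.graph.smul_mem c (hf z)) }
  have : CompleteSpace (mainOperator S).graph := hA.completeSpace_coe
  -- Closed graph theorem: the graph of the main operator is complete, and closedness of S makes the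
  -- graph of C closed.
  have hC : Continuous C := C.continuous_of_seq_closed_graph fun z w y hz hy => by
    have hz' := (continuous_subtype_val.tendsto w).comp hz
    have hlim : Tendsto (fun n => (((z n : X × X).1, (0 : U)), ((z n : X × X).2, C (z n)))) atTop
        (𝓝 (((w : X × X).1, (0 : U)), ((w : X × X).2, y))) :=
      (hz'.fst_nhds.prodMk_nhds tendsto_const_nhds).prodMk_nhds (hz'.snd_nhds.prodMk_nhds hy)
    exact huniq (hS.mem_of_tendsto hlim (.of_forall fun n => hf (z n))) (hf w)
  exact ⟨⟨C, hC⟩, hf⟩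

variable [NormedSpace ℝ X] [IsScalarTower ℝ 𝕜 X]

/-- Orbits of the semigroup starting in the domain of the generator are classical trajectories with
input zero. -/
theorem exists_classicalTrajectory_orbit [CompleteSpace X] [CompleteSpace Y] (hS : S.IsClosed)
    (hT : IsC0Semigroup T) (hA : IsGenerator (mainOperator S) T) {x : X}
    (hx : x ∈ (mainOperator S).domain) :
    ∃ y, IsClassicalTrajectory S (Ici 0) (fun t => T t x) 0 y := by
  obtain ⟨C, hC⟩ := exists_observation hS (hA.isClosed hT)
  have hxg := (mainOperator S).mem_graph ⟨x, hx⟩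
  set x' := mainOperator S ⟨x, hx⟩
  -- Truncating time at 0 keeps the pair in the graph for all real t, so C can be applied to a
  -- globally continuous curve.
  have hmem : ∀ t : ℝ, (T (max t 0) x, T (max t 0) x') ∈ (mainOperator S).graph := fun t =>
    hA.apply_mem_graph hT hxg (le_max_right t 0)
  refine ⟨fun t => C ⟨_, hmem t⟩, hA.contDiffOn hT hxg, continuousOn_const, ?_, fun t ht => ?_⟩
  · have h1 : Continuous fun t => (⟨_, hmem t⟩ : (mainOperator S).graph) :=
      ((hT.continuous_orbit_max x).prodMk (hT.continuous_orbit_max x')).subtype_mk hmem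
    exact (C.continuous.comp h1).continuousOn
  · rw [(hA.hasDerivWithinAt hT hxg ht).derivWithin (uniqueDiffOn_Ici 0 t ht)]
    have h2 := hC ⟨_, hmem t⟩
    simp only [max_eq_left (mem_Ici.1 ht)] at h2 ⊢
    exact h2

/-- Orbits of the semigroup of an infinite-time well-posed system are limits of classical
trajectories with input zero, and their outputs are square integrable. -/
theorem exists_tendsto_orbit [CompleteSpace X] [CompleteSpace Y] (hS : S.IsClosed)
    (hT : IsC0Semigroup T) (hA : IsGenerator (mainOperator S) T) (hwp : IsInfiniteTimeWellPosed S)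
    (x₀ : X) :
    ∃ (y : ℝ → Y) (xk : ℕ → ℝ → X) (yk : ℕ → ℝ → Y), MemL2 y ∧
      (∀ k, IsClassicalTrajectory S (Ici 0) (xk k) 0 (yk k)) ∧
      (∀ t : ℝ, TendstoUniformlyOn xk (fun t => T t x₀) atTop (Icc 0 t)) ∧
      TendstoL2Loc yk y := by
  obtain ⟨ξ, hξ, hξ0⟩ := mem_closure_iff_seq_limit.1 (hA.dense_domain hT x₀)
  choose yk hyk using fun k => exists_classicalTrajectory_orbit hS hT hA (hξ k)
  obtain ⟨c, hc⟩ := hwp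
  have hT0 : ∀ v, T 0 v = v := fun v => by rw [hT.map_zero]; rfl
  -- The difference of two orbits has input zero, so well-posedness bounds its output by the initial
  -- states alone.
  have hdiff : ∀ i : ℕ × ℕ, ∀ t, 0 < t →
      ∫ τ in (0 : ℝ)..t, ‖yk i.1 τ - yk i.2 τ‖ ^ 2 ≤ c * ‖ξ i.1 - ξ i.2‖ ^ 2 := by
    intro i t ht
    have h1 := hc t ht _ _ _ ((hyk i.1).sub (hyk i.2)).isGeneralizedTrajectory
    simp only [Pi.sub_apply, Pi.zero_apply, sub_self, norm_zero, hT0] at h1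
    norm_num at h1
    nlinarith [sq_nonneg ‖T t (ξ i.1) - T t (ξ i.2)‖]
  have hξd : Tendsto (fun i : ℕ × ℕ => c * ‖ξ i.1 - ξ i.2‖ ^ 2) atTop (𝓝 0) := by
    rw [← prod_atTop_atTop_eq]
    have h1 := (hξ0.comp tendsto_fst).sub (hξ0.comp (tendsto_snd (f := atTop (α := ℕ))))
    simpa using (h1.norm.pow 2).const_mul c
  have hm : ∀ k, MemL2Loc (yk k) := fun k => (hyk k).output.memL2Loc
  obtain ⟨y, hy, hty⟩ := exists_tendstoL2Loc hm fun t ht => by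
    rw [tendsto_eLpNorm_two_zero_iff fun i : ℕ × ℕ => (hm i.1 t).sub (hm i.2 t)]
    refine squeeze_zero (fun i => integral_nonneg fun _ => by positivity) (fun i => ?_) hξd
    rcases ht.eq_or_lt with rfl | ht'
    · have h0 := hdiff i 1 one_pos
      simp only [Icc_self, Measure.restrict_singleton, Real.volume_singleton, zero_smul,
        integral_zero_measure]
      exact (intervalIntegral.integral_nonneg zero_le_one fun _ _ => by positivity).trans h0
    · rw [← intervalIntegral_eq_integral_Icc ht]
      exact hdiff i t ht'
  -- The bound does not depend on t, which is exactly what infinite-time well-posedness provides.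
  refine ⟨y, _, yk, hy.memL2_of_bounded (c := c * ‖x₀‖ ^ 2) fun t ht => ?_, hyk, fun t => ?_, hty⟩
  · have h1 := tendsto_intervalIntegral_of_quadratic abs_norm_sq_sub_le (by simp) hm hy hty ht.le
    refine le_of_tendsto_of_tendsto' h1 ((hξ0.norm.pow 2).const_mul c) fun k => ?_
    have h2 := hc t ht _ _ _ (hyk k).isGeneralizedTrajectory
    simp only [Pi.zero_apply, norm_zero, hT0] at h2
    norm_num at h2
    nlinarith [sq_nonneg ‖T t (ξ k)‖]
  · obtain ⟨C, hC⟩ := hT.exists_norm_le t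
    have h1 : Tendsto (fun k => C * ‖x₀ - ξ k‖) atTop (𝓝 0) := by
      simpa using ((hξ0.const_sub x₀).norm).const_mul C
    refine Metric.tendstoUniformlyOn_iff.2 fun ε hε => ?_
    filter_upwards [h1.eventually_lt_const hε] with k hk τ hτ
    rw [dist_eq_norm, ← map_sub]
    exact ((T τ).le_of_opNorm_le (hC τ hτ) _).trans_lt hk

end Nodes

/-! ### From the closed loop back to the original system. -/

section StateFeedback

variable {𝕜 X U Y : Type*} [RCLike 𝕜]
  [NormedAddCommGroup X] [NormedSpace 𝕜 X]
  [NormedAddCommGroup U] [NormedSpace 𝕜 U]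
  [NormedAddCommGroup Y] [NormedSpace 𝕜 Y]
  {S : X × U →ₗ.[𝕜] X × Y} {FG : S.domain →ₗ[𝕜] U}
  {hM : Function.Injective (feedbackMap S FG)}

/-- Undoing M: its second component is v = u - z with z = F&G(x, u), so the original input is z + v.
-/
theorem mem_graph_of_mem_graph_closedLoop {x x' : X} {v z : U} {y : Y}
    (h : ((x, v), (x', (y, z))) ∈ (closedLoop S FG hM).graph) :
    ((x, z + v), (x', y)) ∈ S.graph := by
  obtain ⟨⟨m, hm⟩, h1, h2⟩ := (closedLoop S FG hM).mem_graph_iff.1 h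
  obtain ⟨a, rfl⟩ := hm
  have h3 : extendedMap S FG
      ((LinearEquiv.ofInjective (feedbackMap S FG) hM).symm ⟨feedbackMap S FG a, a, rfl⟩) =
      (x', (y, z)) := h2
  have h4 : (LinearEquiv.ofInjective (feedbackMap S FG) hM).symm
      ⟨feedbackMap S FG a, a, rfl⟩ = a := by
    rw [LinearEquiv.symm_apply_eq]
    rfl
  rw [h4] at h3
  have h5 : ((S a).1, ((S a).2, FG a)) = (x', (y, z)) := h3
  have h6 : (a : X × U) - (0, FG a) = (x, v) := h1
  simp only [Prod.mk.injEq] at h5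
  obtain ⟨h7, h8, h9⟩ := h5
  refine S.mem_graph_iff.2 ⟨a, ?_, Prod.ext h7 h8⟩
  rw [sub_eq_iff_eq_add.1 h6, h9, Prod.mk_add_mk, add_zero, add_comm]

variable [NormedSpace ℝ X]

theorem IsClassicalTrajectory.of_closedLoop {I : Set ℝ} {x : ℝ → X} {v : ℝ → U} {p : ℝ → Y × U}
    (h : IsClassicalTrajectory (closedLoop S FG hM) I x v p) :
    IsClassicalTrajectory S I x (fun t => (p t).2 + v t) fun t => (p t).1 where
  state := h.state
  input := h.output.snd.add h.input
  output := h.output.fst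
  mem_graph t ht := mem_graph_of_mem_graph_closedLoop (h.mem_graph t ht)

/-- Every initial state of a stabilizable system is the initial state of a stable trajectory. -/
theorem exists_stableTrajectory {𝕜 X U Y : Type*} [RCLike 𝕜]
    [NormedAddCommGroup X] [InnerProductSpace 𝕜 X] [CompleteSpace X]
    [NormedSpace ℝ X] [IsScalarTower ℝ 𝕜 X]
    [NormedAddCommGroup U] [InnerProductSpace 𝕜 U] [CompleteSpace U]
    [NormedAddCommGroup Y] [InnerProductSpace 𝕜 Y] [CompleteSpace Y]
    {S : X × U →ₗ.[𝕜] X × Y} (hstab : IsStateFeedbackStabilizable S) (x₀ : X) :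
    ∃ u : ℝ → U, ∃ (x : ℝ → X) (y : ℝ → Y), IsStableTrajectoryFrom S x₀ x u y := by
  obtain ⟨FG, -, hM, hK, hwp, T, hT, hA, hT0⟩ := hstab
  obtain ⟨p, xk, pk, hp, hk, hx, hpk⟩ := exists_tendsto_orbit hK.isClosed hT hA hwp x₀
  have hk' : ∀ k, IsClassicalTrajectory S (Ici 0) (xk k) (fun t => (pk k t).2)
      fun t => (pk k t).1 := fun k => by simpa using (hk k).of_closedLoop
  -- With v = 0 the input to the original system is the feedback output, the second component of
  -- `p`.
  refine ⟨fun t => (p t).2, fun t => T t x₀, fun t => (p t).1, ?_, ?_, hp.snd, hp.fst, hT0 x₀⟩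
  · exact ⟨hT.continuousOn x₀, hp.snd.memL2Loc, hp.fst.memL2Loc, xk, _, _, hk', hx,
      hpk.snd, hpk.fst⟩
  · rw [hT.map_zero]
    rfl

end StateFeedback

end SysNode

/-! ### The main theorem. -/

theorem mainTheorem3 {𝕜 X U Y W : Type*} [RCLike 𝕜]
    [NormedAddCommGroup X] [InnerProductSpace 𝕜 X] [CompleteSpace X]
    [NormedSpace ℝ X] [IsScalarTower ℝ 𝕜 X]
    [NormedAddCommGroup U] [InnerProductSpace 𝕜 U] [CompleteSpace U]
    [NormedAddCommGroup Y] [InnerProductSpace 𝕜 Y] [CompleteSpace Y]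
    [NormedAddCommGroup W] [InnerProductSpace 𝕜 W] [CompleteSpace W]
    (S : X × U →ₗ.[𝕜] X × Y) (hS : SysNode.IsSystemNode S)
    (V : X → ℝ) (hV : SysNode.IsBoundedQuadraticForm 𝕜 V)
    (Q : Y →L[𝕜] Y) (N : U →L[𝕜] Y) (R : U →L[𝕜] U)
    (hQ : IsSelfAdjoint Q) (hR : IsSelfAdjoint R)
    (hdiss : SysNode.IsDissipative S (SysNode.supplyRate Q N R) V)
    (hstab : SysNode.IsStateFeedbackStabilizable S)
    (P : X →L[𝕜] X) (hP : IsSelfAdjoint P) (hPV : ∀ x : X, ((V x : ℝ) : 𝕜) = ⟪x, P x⟫_𝕜)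
    (KL : S.domain →ₗ[𝕜] W) (hKL : SysNode.IsGraphBounded S KL)
    (hLure : SysNode.LureEquation S (SysNode.supplyRate Q N R) P KL)
    (x₀ : X) :
    (∃ u : ℝ → U, ∃ (x : ℝ → X) (y : ℝ → Y), SysNode.IsStableTrajectoryFrom S x₀ x u y) ∧
    ∀ (x : ℝ → X) (u : ℝ → U) (y : ℝ → Y), SysNode.IsStableTrajectoryFrom S x₀ x u y →
      IntegrableOn (fun τ => SysNode.supplyRate Q N R (y τ) (u τ)) (Ici 0) ∧
      ∃ w : ℝ → W, SysNode.IsDissipationOutput S KL x u y w ∧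
        (∀ w' : ℝ → W, SysNode.IsDissipationOutput S KL x u y w' →
          w' =ᵐ[volume.restrict (Ici 0)] w) ∧
        SysNode.MemL2 w ∧
        ∫ τ in Ici (0 : ℝ), ‖w τ‖ ^ 2 = -V x₀ + SysNode.cost (SysNode.supplyRate Q N R) u y := by
  refine ⟨SysNode.exists_stableTrajectory hstab x₀, fun x u y h => ?_⟩
  obtain ⟨C, hs⟩ := SysNode.exists_abs_supplyRate_sub_le Q N R
  have hs0 : SysNode.supplyRate Q N R 0 0 = 0 := SysNode.supplyRate_zero Q N R
  have hPs : (P : X →ₗ[𝕜] X).IsSymmetric :=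
    (ContinuousLinearMap.isSelfAdjoint_iff_isSymmetric).1 hP
  have hint : IntegrableOn (fun τ => SysNode.supplyRate Q N R (y τ) (u τ)) (Ici 0) :=
    SysNode.integrable_of_quadratic
      (b := fun v : Y × U => SysNode.supplyRate Q N R v.1 v.2) hs hs0 (h.output.prodMk h.input)
  obtain ⟨w, hw⟩ := h.generalized.exists_dissipationOutput hs hs0 hPs hLure hKL
  have hVx : RCLike.re ⟪x 0, P (x 0)⟫_𝕜 = V x₀ := by
    rw [h.initial, ← hPV, RCLike.ofReal_re]
  obtain ⟨hw2, hweq⟩ := hw.memL2_and_integral_eq hs hs0 hPs hLure hint h.tendsto_zero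
  rw [hVx] at hweq
  exact ⟨hint, w, hw, fun w' hw' => hw'.ae_eq hs hs0 hPs hLure hw, hw2, hweq⟩
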